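/- Let $p$ be a prime, let $\mathcal{O}$ be the ring of integers of a finite extension of $\mathbb{Q}_p$ (equivalently, a complete discrete valuation ring of characteristic $0$ with finite residue field of characteristic $p$), and let $\varpi$ be a uniformizer of $\mathcal{O}$. Let $\Gamma$ be a topological group isomorphic to $\mathbb{Z}_p$, written multiplicatively, and let $\Lambda=\mathcal{O}[[\Gamma]]=\varprojlim_n \mathcal{O}[\Gamma/\Gamma^{p^n}]$ be its Iwasawa algebra. For every finitely generated $\Lambda$-module $M$ there is a pseudo-isomorphism, that is, a $\Lambda$-linear map with finite kernel and finite cokernel, \[ M\longrightarrow \Lambda^{\oplus r}\oplus\bigoplus_{i=1}^s \Lambda/(\varpi^{a_i})\oplus\bigoplus_{j=1}^t\Lambda/(F_j), \] where $r,s,t\ge 0$ and $a_i\ge 1$ are integers and the $F_j$ are distinguished polynomials over $\mathcal{O}$ in $X=\gamma-1$, with $\gamma$ a topological generator of $\Gamma$. The $\mu$-invariant of $M$ is $\mu(M)=\sum_{i=1}^s a_i$; it does not depend on the choices. Let $M$ and $M'$ be two finitely generated $\Lambda$-modules such that $\mathrm{rank}_\Lambda M=\mathrm{rank}_\Lambda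 M'$ and $M/\varpi M\cong M'/\varpi M'$ as $\Lambda$-modules. Then $\mu(M)=0$ if and only if $\mu(M')=0$. -/

import Mathlib

/-- The subgroup `Γ_n = Γ ^ (p ^ n)` of a commutative group `Γ` (written multiplicatively). -/
def powSubgroup (p : ℕ) (Γ : Type*) [CommGroup Γ] (n : ℕ) : Subgroup Γ :=
  (powMonoidHom (p ^ n) : Γ →* Γ).range

theorem powSubgroup_anti (p : ℕ) (Γ : Type*) [CommGroup Γ] {m n : ℕ} (h : m ≤ n) :
    powSubgroup p Γ n ≤ powSubgroup p Γ m := by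
  rintro _ ⟨g, rfl⟩
  refine ⟨g ^ (p ^ (n - m)), ?_⟩
  simp only [powMonoidHom_apply]
  rw [← pow_mul, ← pow_add, Nat.sub_add_cancel h]

/-- The natural projection `Γ / Γ_n → Γ / Γ_m` for `m ≤ n`. -/
def layerMap (p : ℕ) (Γ : Type*) [CommGroup Γ] {m n : ℕ} (h : m ≤ n) :
    Γ ⧸ powSubgroup p Γ n →* Γ ⧸ powSubgroup p Γ m :=
  QuotientGroup.map _ _ (MonoidHom.id Γ) (powSubgroup_anti p Γ h)

/-- The projective limit of the group rings `O[Γ / Γ_n]`, as a subalgebra of their product. -/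
noncomputable def iwasawaSubalgebra (p : ℕ) (O : Type*) [CommRing O] (Γ : Type*) [CommGroup Γ] :
    Subalgebra O (∀ n : ℕ, MonoidAlgebra O (Γ ⧸ powSubgroup p Γ n)) where
  carrier := {x | ∀ (m n : ℕ) (h : m ≤ n),
    MonoidAlgebra.mapDomainAlgHom O O (layerMap p Γ h) (x n) = x m}
  mul_mem' := by
    intro x y hx hy m n h
    rw [Pi.mul_apply, map_mul, hx m n h, hy m n h, Pi.mul_apply]
  add_mem' := by
    intro x y hx hy m n h
    rw [Pi.add_apply, map_add, hx m n h, hy m n h, Pi.add_apply]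
  algebraMap_mem' := by
    intro r m n h
    rw [Pi.algebraMap_apply, AlgHom.commutes, Pi.algebraMap_apply]

/-- The Iwasawa algebra `O[[Γ]]`, the projective limit of the group rings `O[Γ / Γ ^ (p ^ n)]`
(for `Γ ≅ ℤ_p`, the subgroups `Γ ^ (p ^ n)` form a basis of the open subgroups). -/
def IwasawaAlgebra (p : ℕ) (O : Type*) [CommRing O] (Γ : Type*) [CommGroup Γ] : Type _ :=
  iwasawaSubalgebra p O Γ

noncomputable instance IwasawaAlgebra.instCommRing (p : ℕ) (O : Type*) [CommRing O]
    (Γ : Type*) [CommGroup Γ] : CommRing (IwasawaAlgebra p O Γ) :=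
  inferInstanceAs (CommRing (iwasawaSubalgebra p O Γ))

noncomputable instance IwasawaAlgebra.instAlgebra (p : ℕ) (O : Type*) [CommRing O]
    (Γ : Type*) [CommGroup Γ] : Algebra O (IwasawaAlgebra p O Γ) :=
  inferInstanceAs (Algebra O (iwasawaSubalgebra p O Γ))

/-- The group element `γ`, viewed in the Iwasawa algebra `O[[Γ]]`. -/
noncomputable def IwasawaAlgebra.of (p : ℕ) (O : Type*) [CommRing O] {Γ : Type*} [CommGroup Γ]
    (γ : Γ) : IwasawaAlgebra p O Γ :=
  ⟨fun n => MonoidAlgebra.of O (Γ ⧸ powSubgroup p Γ n) (QuotientGroup.mk γ), by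
    intro m n h
    simp only [MonoidAlgebra.of_apply, MonoidAlgebra.mapDomainAlgHom_apply,
      MonoidAlgebra.mapDomain_single]
    rfl⟩

/-- The value `F(γ - 1)` in `O[[Γ]]` of a polynomial `F(X)` over `O`; when `γ` is a topological
generator of `Γ ≅ ℤ_p`, this is `F` under the usual identification `O[[Γ]] = O[[X]]`. -/
noncomputable def polyAt (p : ℕ) {O : Type*} [CommRing O] {Γ : Type*} [CommGroup Γ]
    (γ : Γ) (F : Polynomial O) : IwasawaAlgebra p O Γ :=
  Polynomial.aeval (IwasawaAlgebra.of p O γ - 1) F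

/-- The quotient `M / ϖ M` of a module over `O[[Γ]]`, for `ϖ ∈ O`. -/
abbrev ModUniformizer (p : ℕ) {O : Type*} [CommRing O] (Γ : Type*) [CommGroup Γ] (ϖ : O)
    (M : Type*) [AddCommGroup M] [Module (IwasawaAlgebra p O Γ) M] : Type _ :=
  M ⧸ (Ideal.span {algebraMap O (IwasawaAlgebra p O Γ) ϖ} •
    (⊤ : Submodule (IwasawaAlgebra p O Γ) M))

/-- A pseudo-isomorphism: a linear map with finite kernel and finite cokernel. -/
def IsPseudoIso {R M N : Type*} [CommRing R] [AddCommGroup M] [Module R M]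
    [AddCommGroup N] [Module R N] (f : M →ₗ[R] N) : Prop :=
  Finite (LinearMap.ker f) ∧ Finite (N ⧸ LinearMap.range f)

/-- The elementary module `Λ ^ r ⊕ ⨁ i, Λ / ϖ ^ (a i) ⊕ ⨁ j, Λ / (F j)` over `Λ = O[[Γ]]`. -/
abbrev ElementaryModule (p : ℕ) {O : Type*} [CommRing O] {Γ : Type*} [CommGroup Γ] (ϖ : O) (γ : Γ)
    (r : ℕ) {s : ℕ} (a : Fin s → ℕ) {t : ℕ} (F : Fin t → Polynomial O) : Type _ :=
  (Fin r → IwasawaAlgebra p O Γ) ×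
  (∀ i : Fin s, IwasawaAlgebra p O Γ ⧸
    Ideal.span {algebraMap O (IwasawaAlgebra p O Γ) ϖ ^ a i}) ×
  (∀ j : Fin t, IwasawaAlgebra p O Γ ⧸ Ideal.span {polyAt p γ (F j)})

/-- `HasMuInvariant p Γ ϖ M m` says that there is a pseudo-isomorphism
`M → Λ ^ r ⊕ ⨁ i, Λ / ϖ ^ (a i) ⊕ ⨁ j, Λ / (F j)` with all `a i ≥ 1` and all `F j`
distinguished polynomials (in `X = γ - 1`, for a topological generator `γ` of `Γ`),
and that `m = ∑ i, a i`. -/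
def HasMuInvariant (p : ℕ) {O : Type*} [CommRing O] [IsLocalRing O]
    (Γ : Type*) [CommGroup Γ] [TopologicalSpace Γ] (ϖ : O)
    (M : Type*) [AddCommGroup M] [Module (IwasawaAlgebra p O Γ) M] (m : ℕ) : Prop :=
  ∃ (γ : Γ) (r s t : ℕ) (a : Fin s → ℕ) (F : Fin t → Polynomial O)
    (f : M →ₗ[IwasawaAlgebra p O Γ] ElementaryModule p ϖ γ r a F),
    Dense (Subgroup.zpowers γ : Set Γ) ∧
    (∀ i, 1 ≤ a i) ∧
    (∀ j, (F j).IsDistinguishedAt (IsLocalRing.maximalIdeal O)) ∧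
    IsPseudoIso f ∧ m = ∑ i, a i

/-- The `μ`-invariant of a finitely generated `O[[Γ]]`-module: the value `∑ i, a i` attached to
its pseudo-isomorphism with an elementary module. By the structure theorem exactly one `m`
satisfies `HasMuInvariant p Γ ϖ M m`, and the infimum below is this `m`. -/
noncomputable def muInvariant (p : ℕ) {O : Type*} [CommRing O] [IsLocalRing O]
    (Γ : Type*) [CommGroup Γ] [TopologicalSpace Γ] (ϖ : O)
    (M : Type*) [AddCommGroup M] [Module (IwasawaAlgebra p O Γ) M] : ℕ :=
  sInf {m : ℕ | HasMuInvariant p Γ ϖ M m}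

/-!
Write `Λ = O[[Γ]]`. The proof characterizes the vanishing of `μ(M)` by ranks, which depend only on
`rank_Λ M` and on `M / ϖ M`.

**The criterion.** Suppose `M` is pseudo-isomorphic to
`Λ ^ r ⊕ ⨁ Λ / (ϖ ^ a i) ⊕ ⨁ Λ / (F j)` with `s` summands in the middle. Put `X = γ - 1`. Every
element of a finite `Λ`-module is annihilated by a power of `X`, and `X` is not divisible by `ϖ`,
so a pseudo-isomorphism preserves the rank over `Λ` and, after reduction modulo `ϖ`, the rank over
the domain `Λ / ϖ`. A distinguished polynomial is nonzero modulo `ϖ`, so the summands `Λ / (F j)`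
contribute to neither rank. Hence `rank_Λ M = r` (`finrank_eq_of_isPseudoIso`) and
`rank_{Λ / ϖ} (M / ϖ M) = r + s` (`finrank_quotient_eq_of_isPseudoIso`), and `μ(M) = 0` if and
only if the two ranks agree (`muInvariant_eq_zero_iff`).

**The structure theorem.** Since `muInvariant` is the infimum of the values attached to all
pseudo-isomorphisms with elementary modules, the criterion also needs the existence of one
(`exists_hasMuInvariant`). It is proved for a noetherian factorial domain `A` with a prime element
`ϖ` of its Jacobson radical, such that `A / ϖ` is a principal ideal domain and `A / (a, b)` is
finite for coprime `a`, `b` (`exists_isPseudoIso_elementary`). Two maps out of `M` are combined.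

* The torsion-free quotient of `M` is embedded in some `A ^ r` and then in the largest submodule `P`
  of `A ^ r` in which it has finite index. This `P` is saturated, which makes `P / ϖ P`
  torsion-free over `A / ϖ`, hence free, and so `P` is free (`exists_injective_finite_quotient`).
* Let `d` annihilate the torsion of `M`. By prime avoidance, inverting the elements prime to `d`
  turns `A` into a principal ideal domain, where the classical structure theorem applies; clearing
  denominators in the projection to the torsion part gives a map from `M` to a product of
  `A / (π ^ e)` (`exists_map_torsion`).

The kernel of the combined map, and the part of its cokernel which does not come from the free
module, are annihilated by coprime elements and are therefore finite.

**The ring.** The hypotheses on `A` are checked for `O⟦X⟧` by Weierstrass preparation: every nonzero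
prime contains `ϖ` or a distinguished polynomial which is a prime element
(`exists_mem_of_isPrime_powerSeries`), so that `O⟦X⟧` is factorial by Kaplansky's criterion, and a
prime containing two coprime elements is maximal. They carry over to `Λ` by the isomorphism
`O⟦X⟧ ≃ Λ` sending `X` to `γ - 1` (`powerSeriesEquivIwasawa`): Weierstrass division by
`(1 + X) ^ (p ^ n) - 1` identifies the quotient by this polynomial with `O[Γ / Γ ^ (p ^ n)]`, and
`O⟦X⟧` is the limit of these quotients because it is complete for its maximal ideal.
-/

/-! ### Modules over a noetherian factorial domain whose coprime quotients are finite -/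

/-- A finitely generated module annihilated by an ideal of finite index is finite. -/
theorem finite_of_ideal_smul_eq_zero {A N : Type*} [CommRing A] [AddCommGroup N] [Module A N]
    [Module.Finite A N] (J : Ideal A) [Finite (A ⧸ J)]
    (h : ∀ j ∈ J, ∀ n : N, j • n = 0) : Finite N := by
  have hbot : J • (⊤ : Submodule A N) = ⊥ := by
    rw [eq_bot_iff, Submodule.smul_le]
    intro r hr n _
    simpa using h r hr n
  have hfin : Finite (N ⧸ J • (⊤ : Submodule A N)) :=
    Submodule.finite_quotient_smul J Module.Finite.fg_top
  rw [hbot] at hfin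
  exact Finite.of_equiv _ (Submodule.quotEquivOfEqBot (⊥ : Submodule A N) rfl).toEquiv

/-- If `A / (a, b)` is finite for coprime `a`, `b`, then a finitely generated module is finite as
soon as each of its elements is annihilated by two coprime elements of `A`. -/
theorem finite_of_forall_exists_isRelPrime {A N : Type*} [CommRing A] [AddCommGroup N] [Module A N]
    [Module.Finite A N] (hfin : ∀ a b : A, IsRelPrime a b → Finite (A ⧸ Ideal.span {a, b}))
    (h : ∀ n : N, ∃ a b : A, IsRelPrime a b ∧ a • n = 0 ∧ b • n = 0) : Finite N := by
  obtain ⟨s, hs⟩ := Module.Finite.fg_top (R := A) (M := N)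
  choose a b hab ha hb using h
  have hJ : Finite (A ⧸ ∏ n ∈ s, Ideal.span {a n, b n}) :=
    Ideal.finite_quotient_prod _ s (fun n _ => Submodule.fg_span (by simp))
      (fun n _ => hfin _ _ (hab n))
  refine finite_of_ideal_smul_eq_zero (∏ n ∈ s, Ideal.span {a n, b n}) fun j hj n => ?_
  have hn : n ∈ Submodule.span A (s : Set N) := by rw [hs]; trivial
  induction hn using Submodule.span_induction with
  | mem x hx =>
    obtain ⟨u, v, rfl⟩ := Ideal.mem_span_pair.1 (Ideal.prod_le_inf.trans (Finset.inf_le hx) hj)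
    rw [add_smul, mul_smul, mul_smul, ha, hb, smul_zero, smul_zero, add_zero]
  | zero => exact smul_zero _
  | add x y _ _ hx hy => rw [smul_add, hx, hy, add_zero]
  | smul c x _ hx => rw [smul_comm, hx, smul_zero]

/-- A finitely generated torsion-free module over a noetherian domain embeds in a free module
of finite rank. -/
theorem exists_injective_fin_fun {A N : Type*} [CommRing A] [IsDomain A] [IsNoetherianRing A]
    [AddCommGroup N] [Module A N] [Module.Finite A N]
    (htf : ∀ (a : A) (n : N), a • n = 0 → a = 0 ∨ n = 0) :
    ∃ (r : ℕ) (f : N →ₗ[A] (Fin r → A)), Function.Injective f := by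
  let S := nonZeroDivisors A
  let K := FractionRing A
  let V := LocalizedModule S N
  let b := Module.finBasis K V
  let q : N →ₗ[A] (Fin (Module.finrank K V) → K) :=
    (b.equivFun.toLinearMap.restrictScalars A) ∘ₗ LocalizedModule.mkLinearMap S N
  have hq : Function.Injective q := by
    refine b.equivFun.injective.comp ?_
    rw [← LinearMap.ker_eq_bot, LinearMap.ker_eq_bot']
    intro n hn
    obtain ⟨s, hs⟩ := (IsLocalizedModule.eq_zero_iff S (LocalizedModule.mkLinearMap S N)).1 hn
    exact (htf _ _ hs).resolve_left (nonZeroDivisors.ne_zero s.2)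
  have : Module.FinitePresentation A N := Module.finitePresentation_of_finite A N
  obtain ⟨h, s, hs⟩ := Module.FinitePresentation.exists_lift_of_isLocalizedModule S
    (LinearMap.pi fun i : Fin (Module.finrank K V) => Algebra.linearMap A K ∘ₗ LinearMap.proj i) q
  refine ⟨_, h, ?_⟩
  rw [← LinearMap.ker_eq_bot, LinearMap.ker_eq_bot']
  intro n hn
  have h0 : (s : A) • q n = 0 := by
    have := LinearMap.congr_fun hs n
    rw [LinearMap.comp_apply, hn, map_zero] at this
    exact this.symm
  rw [← map_smul, ← q.map_zero] at h0
  exact (htf _ _ (hq h0)).resolve_left (nonZeroDivisors.ne_zero s.2)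

/-- A submodule `P` of `A ^ r` is free if `z ∈ P` whenever `ϖ z` and `b z` are in `P` for some `b`
prime to `ϖ`: in that case `P / ϖ P` is torsion-free over the principal ideal domain `A / ϖ`. -/
theorem free_of_saturated {A : Type*} [CommRing A] [IsDomain A] [IsNoetherianRing A]
    {ϖ : A} (hϖ : Prime ϖ) (hjac : ϖ ∈ Ideal.jacobson (⊥ : Ideal A))
    [IsPrincipalIdealRing (A ⧸ Ideal.span {ϖ})] {r : ℕ} (P : Submodule A (Fin r → A))
    (hP : ∀ (b : A) (z : Fin r → A), ¬ ϖ ∣ b → ϖ • z ∈ P → b • z ∈ P → z ∈ P) :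
    Module.Free A P := by
  have : Module.FinitePresentation A P := Module.finitePresentation_of_finite A P
  have hprime : (Ideal.span {ϖ}).IsPrime := (Ideal.span_singleton_prime hϖ.ne_zero).2 hϖ
  have hdom : IsDomain (A ⧸ Ideal.span {ϖ}) := Ideal.Quotient.isDomain _
  have hreg : IsSMulRegular P ϖ := by
    intro x y hxy
    ext i
    have := congrFun (congrArg Subtype.val hxy) i
    exact mul_left_cancel₀ hϖ.ne_zero this
  rw [← Module.free_quotSMulTop_iff_free A P hjac hreg]
  have : Module.Finite (A ⧸ Ideal.span {ϖ}) (QuotSMulTop ϖ P) :=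
    Module.Finite.of_restrictScalars_finite A _ _
  rw [Module.free_iff_isTorsionFree]
  rw [Module.isTorsionFree_iff_smul_eq_zero]
  intro c m hcm
  obtain ⟨b, rfl⟩ := Ideal.Quotient.mk_surjective c
  obtain ⟨n, rfl⟩ := Submodule.Quotient.mk_surjective _ m
  rw [or_iff_not_imp_left, Ideal.Quotient.eq_zero_iff_mem, Ideal.mem_span_singleton]
  intro hb
  change Submodule.Quotient.mk (b • n) = _ at hcm
  rw [Submodule.Quotient.mk_eq_zero, Submodule.mem_smul_pointwise_iff_exists] at hcm ⊢
  obtain ⟨y, -, hy⟩ := hcm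
  have hyn : ∀ i, ϖ * (y : Fin r → A) i = b * (n : Fin r → A) i := fun i =>
    congrFun (congrArg Subtype.val hy) i
  have hdvd : ∀ i, ϖ ∣ (n : Fin r → A) i := fun i =>
    (hϖ.dvd_or_dvd (Dvd.intro _ (hyn i))).resolve_left hb
  choose z hz using hdvd
  have hzn : ϖ • z = n := funext fun i => (hz i).symm
  have hzy : b • z = y := funext fun i => by
    refine mul_left_cancel₀ hϖ.ne_zero ?_
    rw [hyn i, hz i, Pi.smul_apply, smul_eq_mul]
    ring
  refine ⟨⟨z, hP b z hb (hzn ▸ n.2) (hzy ▸ y.2)⟩, trivial, Subtype.ext hzn⟩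

/-- A finitely generated torsion-free module embeds in a free module with finite cokernel: inside
an arbitrary embedding into `A ^ r`, the largest submodule in which the module has finite index
is saturated, hence free. -/
theorem exists_injective_finite_quotient {A N : Type*} [CommRing A] [IsDomain A]
    [IsNoetherianRing A] [AddCommGroup N] [Module A N] [Module.Finite A N]
    {ϖ : A} (hϖ : Prime ϖ) (hjac : ϖ ∈ Ideal.jacobson (⊥ : Ideal A))
    [IsPrincipalIdealRing (A ⧸ Ideal.span {ϖ})]
    (hfin : ∀ a b : A, IsRelPrime a b → Finite (A ⧸ Ideal.span {a, b}))
    (htf : ∀ (a : A) (n : N), a • n = 0 → a = 0 ∨ n = 0) :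
    ∃ (r : ℕ) (f : N →ₗ[A] (Fin r → A)), Function.Injective f ∧
      Finite ((Fin r → A) ⧸ LinearMap.range f) := by
  obtain ⟨r, f, hf⟩ := exists_injective_fin_fun htf
  -- the submodules of `A ^ r` in which the image of `N` has finite index
  let C : Set (Submodule A (Fin r → A)) :=
    {P | LinearMap.range f ≤ P ∧ ∃ J : Ideal A, Finite (A ⧸ J) ∧ J • P ≤ LinearMap.range f}
  have hC : C.Nonempty := ⟨LinearMap.range f, le_rfl, ⊤, inferInstance, by simp⟩
  obtain ⟨P, ⟨hNP, J, hJ, hJP⟩, hmax⟩ :=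
    set_has_maximal_iff_noetherian.2 (inferInstance : IsNoetherian A (Fin r → A)) C hC
  have hsat : ∀ (b : A) (z : Fin r → A), ¬ ϖ ∣ b → ϖ • z ∈ P → b • z ∈ P → z ∈ P := by
    intro b z hb hz hbz
    by_contra hzP
    have hfin' := hfin ϖ b (hϖ.irreducible.isRelPrime_iff_not_dvd.2 hb)
    refine hmax (P ⊔ Submodule.span A {z}) ⟨hNP.trans le_sup_left, J * Ideal.span {ϖ, b}, ?_, ?_⟩
      (left_lt_sup.2 fun h => hzP (h (Submodule.mem_span_singleton_self z)))
    · exact Submodule.finite_quotient_smul J (N := Ideal.span {ϖ, b})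
        (Submodule.fg_span (by simp))
    · rw [← smul_eq_mul, Submodule.smul_assoc]
      refine le_trans (Submodule.smul_mono le_rfl ?_) hJP
      rw [Submodule.smul_sup]
      refine sup_le Submodule.smul_le_right ?_
      rw [Submodule.span_smul_span, Submodule.span_le]
      rintro _ ⟨c, hc, y, hy, rfl⟩
      rw [Set.mem_singleton_iff] at hy
      rcases hc with rfl | hc
      · simpa [hy] using hz
      · rw [Set.mem_singleton_iff] at hc
        simpa [hy, hc] using hbz
  have hfree : Module.Free A P := free_of_saturated hϖ hjac P hsat
  let e := (Module.finBasis A P).equivFun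
  let f' : N →ₗ[A] P := f.codRestrict P fun n => hNP ⟨n, rfl⟩
  refine ⟨_, e.toLinearMap ∘ₗ f', e.injective.comp fun x y h => hf (congrArg Subtype.val h), ?_⟩
  refine finite_of_ideal_smul_eq_zero J fun j hj n => ?_
  obtain ⟨n, rfl⟩ := Submodule.Quotient.mk_surjective _ n
  obtain ⟨n, rfl⟩ := e.surjective n
  rw [← Submodule.Quotient.mk_smul, Submodule.Quotient.mk_eq_zero, ← map_smul]
  obtain ⟨m, hm⟩ := hJP (Submodule.smul_mem_smul hj n.2)
  exact ⟨m, congrArg e (Subtype.ext hm)⟩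

/-! ### Localization at the elements prime to a given element -/

/-- The multiplicative set of the elements prime to `d`. -/
def relPrimeSubmonoid {A : Type*} [CommRing A] [IsDomain A] [UniqueFactorizationMonoid A] (d : A) :
    Submonoid A where
  carrier := {s | IsRelPrime s d}
  one_mem' := isRelPrime_one_left
  mul_mem' := IsRelPrime.mul_left

theorem relPrimeSubmonoid_le_nonZeroDivisors {A : Type*} [CommRing A] [IsDomain A]
    [UniqueFactorizationMonoid A] {d : A} (hd : ¬ IsUnit d) :
    relPrimeSubmonoid d ≤ nonZeroDivisors A := by
  intro s hs
  rw [mem_nonZeroDivisors_iff_ne_zero]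
  rintro rfl
  exact hd (isRelPrime_zero_left.1 hs)

/-- By prime avoidance, the nonzero primes of the localization at the elements prime to `d` are
the ideals generated by the prime divisors of `d`. -/
theorem exists_prime_dvd_of_isPrime_localization {A B : Type*} [CommRing A] [IsDomain A]
    [UniqueFactorizationMonoid A] [CommRing B] [Algebra A B] {d : A} (hd : d ≠ 0)
    [IsLocalization (relPrimeSubmonoid d) B] (Q : Ideal B) [hQ : Q.IsPrime] (hQ0 : Q ≠ ⊥) :
    ∃ π : A, Prime π ∧ π ∣ d ∧ Q = Ideal.span {algebraMap A B π} := by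
  classical
  set P : Ideal A := Q.under A
  have hPprime : P.IsPrime := inferInstance
  have hdisj : Disjoint (relPrimeSubmonoid d : Set A) (P : Set A) :=
    ((IsLocalization.isPrime_iff_isPrime_disjoint (relPrimeSubmonoid d) B Q).1 hQ).2
  have hmap : Ideal.map (algebraMap A B) P = Q :=
    IsLocalization.map_under (relPrimeSubmonoid d) B Q
  have hP0 : P ≠ ⊥ := by
    rintro h
    rw [h, Ideal.map_bot] at hmap
    exact hQ0 hmap.symm
  have hdvd : ∀ y ∈ P, ∃ π, Prime π ∧ π ∣ y ∧ π ∣ d := by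
    intro y hy
    have hyS : ¬ IsRelPrime y d := fun h => Set.disjoint_left.1 hdisj h hy
    by_contra! hcon
    refine hyS (isRelPrime_comm.1
      ((UniqueFactorizationMonoid.isRelPrime_iff_no_prime_factors hd).2 ?_))
    intro π hπd hπy hπ
    exact hcon π hπ hπy hπd
  obtain ⟨π, hπP, hπ⟩ := hPprime.exists_mem_prime_of_ne_bot hP0
  have hπd : π ∣ d := by
    obtain ⟨σ, hσ, hσπ, hσd⟩ := hdvd π hπP
    exact (hσ.associated_of_dvd hπ hσπ).symm.dvd.trans hσd
  refine ⟨π, hπ, hπd, ?_⟩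
  have hcover : (P : Set A) ⊆
      ⋃ σ ∈ (↑(UniqueFactorizationMonoid.factors d).toFinset : Set A),
        (Ideal.span {σ} : Set A) := by
    intro y hy
    obtain ⟨σ, hσ, hσy, hσd⟩ := hdvd y hy
    obtain ⟨τ, hτ, hστ⟩ := UniqueFactorizationMonoid.exists_mem_factors_of_dvd hd hσ.irreducible hσd
    simp only [Set.mem_iUnion]
    exact ⟨τ, by simpa using hτ, Ideal.mem_span_singleton.2 (hστ.symm.dvd.trans hσy)⟩
  obtain ⟨σ, hσ, hPσ⟩ := (Ideal.subset_union_prime (0 : A) 0 fun σ hσ _ _ =>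
    (Ideal.span_singleton_prime (UniqueFactorizationMonoid.prime_of_factor σ
      (by simpa using hσ)).ne_zero).2
      (UniqueFactorizationMonoid.prime_of_factor σ (by simpa using hσ))).1 hcover
  have hσp : Prime σ := UniqueFactorizationMonoid.prime_of_factor σ (by simpa using hσ)
  have hπσ : Associated σ π := hσp.associated_of_dvd hπ (Ideal.mem_span_singleton.1 (hPσ hπP))
  have hPπ : P = Ideal.span {π} := by
    refine le_antisymm ?_ ((Ideal.span_singleton_le_iff_mem _).2 hπP)
    rwa [Ideal.span_singleton_eq_span_singleton.2 hπσ] at hPσ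
  rw [← hmap, hPπ, Ideal.map_span, Set.image_singleton]

theorem isPrincipalIdealRing_localization {A B : Type*} [CommRing A] [IsDomain A]
    [UniqueFactorizationMonoid A] [CommRing B] [Algebra A B] {d : A} (hd : d ≠ 0)
    [IsLocalization (relPrimeSubmonoid d) B] : IsPrincipalIdealRing B :=
  IsPrincipalIdealRing.of_prime_ne_bot fun Q hQ hQ0 => by
    obtain ⟨π, -, -, h⟩ := exists_prime_dvd_of_isPrime_localization (A := A) hd Q hQ0
    exact ⟨⟨_, h⟩⟩

/-- Structure of a finitely generated module after inverting the elements prime to `d`: the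
torsion part of the localization is that of a product of modules `A / (π ^ e)`, where `π` is a
prime divisor of `d`. -/
theorem exists_localized_equiv {A : Type u} {M : Type v} [CommRing A] [IsDomain A]
    [UniqueFactorizationMonoid A] [AddCommGroup M] [Module A M] [Module.Finite A M] {d : A}
    (hd : d ≠ 0) (hd' : ¬ IsUnit d) :
    ∃ (r : ℕ) (ι : Type u) (_ : Fintype ι) (π : ι → A) (e : ι → ℕ),
      (∀ i, Prime (π i)) ∧ (∀ i, π i ∣ d) ∧
      Nonempty (LocalizedModule (relPrimeSubmonoid d) M ≃ₗ[Localization (relPrimeSubmonoid d)]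
        (Fin r → Localization (relPrimeSubmonoid d)) ×
        (∀ i, Localization (relPrimeSubmonoid d) ⧸ Submodule.localized'
          (Localization (relPrimeSubmonoid d)) (relPrimeSubmonoid d)
          (Algebra.linearMap A (Localization (relPrimeSubmonoid d)))
          (Ideal.span {π i ^ e i}))) := by
  set S := relPrimeSubmonoid d
  have hdom : IsDomain (Localization S) :=
    IsLocalization.isDomain_localization (relPrimeSubmonoid_le_nonZeroDivisors hd')
  have hpid : IsPrincipalIdealRing (Localization S) := isPrincipalIdealRing_localization hd
  obtain ⟨r, ι, hι, q, hq, e, ⟨φ⟩⟩ :=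
    Module.equiv_free_prod_directSum (Localization S) (LocalizedModule S M)
  have hπ : ∀ i, ∃ π : A, Prime π ∧ π ∣ d ∧
      Ideal.span {q i} = Ideal.span {algebraMap A (Localization S) π} := fun i => by
    have : (Ideal.span {q i}).IsPrime :=
      (Ideal.span_singleton_prime (hq i).ne_zero).2 (hq i).prime
    exact exists_prime_dvd_of_isPrime_localization hd _
      (by simpa using (hq i).ne_zero)
  choose π hπ hπd hπq using hπ
  have heq : ∀ i, Submodule.span (Localization S) {q i ^ e i} = Submodule.localized'
      (Localization S) S (Algebra.linearMap A (Localization S)) (Ideal.span {π i ^ e i}) := by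
    intro i
    rw [Ideal.span, Submodule.localized'_span, Set.image_singleton, Algebra.linearMap_apply,
      map_pow]
    change Ideal.span {q i ^ e i} = Ideal.span {_}
    rw [← Ideal.span_singleton_pow, ← Ideal.span_singleton_pow, hπq i]
  classical
  exact ⟨r, ι, hι, π, e, hπ, hπd, ⟨φ ≪≫ₗ LinearEquiv.prodCongr
    (Finsupp.linearEquivFunOnFinite _ _ _)
    (DirectSum.linearEquivFunOnFintype _ _ _ ≪≫ₗ
      LinearEquiv.piCongrRight fun i => Submodule.quotEquivOfEq _ _ (heq i))⟩⟩

/-! ### Pseudo-isomorphisms with elementary modules -/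

theorem exists_ne_zero_forall_torsion_smul_eq_zero (A M : Type*) [CommRing A] [IsDomain A]
    [IsNoetherianRing A] [AddCommGroup M] [Module A M] [Module.Finite A M] :
    ∃ d : A, d ≠ 0 ∧ ∀ x ∈ Submodule.torsion A M, d • x = 0 := by
  obtain ⟨d, hd, hd'⟩ := Submodule.annihilator_top_inter_nonZeroDivisors
    (Submodule.torsion_isTorsion (R := A) (M := M))
  refine ⟨d, nonZeroDivisors.ne_zero hd', fun x hx => ?_⟩
  exact congrArg Subtype.val (Submodule.mem_annihilator.1 hd ⟨x, hx⟩ trivial)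

theorem prod_smul_eq_zero_of_quotient {A ι : Type*} [CommRing A] [Fintype ι] (F : ι → A)
    (y : ∀ j, A ⧸ Ideal.span {F j}) : (∏ j, F j) • y = 0 := by
  funext j
  obtain ⟨z, hz⟩ := Submodule.Quotient.mk_surjective _ (y j)
  rw [Pi.smul_apply, ← hz, ← Submodule.Quotient.mk_smul, Pi.zero_apply,
    Submodule.Quotient.mk_eq_zero, smul_eq_mul]
  exact Ideal.mul_mem_right _ _ (Ideal.mem_span_singleton.2
    (Finset.dvd_prod_of_mem F (Finset.mem_univ j)))

/-- A map from `M` to a product of modules `A / (π ^ e)`, with `π` a prime divisor of `d`, that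
becomes an isomorphism on the torsion submodule once the elements prime to `d` are inverted. It
is obtained by clearing denominators in the projection of the localization to its torsion part. -/
theorem exists_map_torsion {A : Type u} {M : Type v} [CommRing A] [IsDomain A]
    [IsNoetherianRing A] [UniqueFactorizationMonoid A] [AddCommGroup M] [Module A M]
    [Module.Finite A M] {d : A} (hd : d ≠ 0) (hd' : ¬ IsUnit d) :
    ∃ (ι : Type u) (_ : Fintype ι) (π : ι → A) (e : ι → ℕ)
      (g : M →ₗ[A] ∀ i, A ⧸ Ideal.span {π i ^ e i}),
      (∀ i, Prime (π i)) ∧ (∀ i, π i ∣ d) ∧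
      (∀ x ∈ Submodule.torsion A M, g x = 0 → ∃ s, IsRelPrime s d ∧ s • x = 0) ∧
      (∀ y, ∃ s, IsRelPrime s d ∧ ∃ x ∈ Submodule.torsion A M, g x = s • y) := by
  obtain ⟨r, ι, hι, π, e, hπ, hπd, ⟨φ⟩⟩ := exists_localized_equiv (M := M) hd hd'
  set S := relPrimeSubmonoid d
  have hS0 : S ≤ nonZeroDivisors A := relPrimeSubmonoid_le_nonZeroDivisors hd'
  let L : ι → Submodule (Localization S) (Localization S) := fun i =>
    Submodule.localized' (Localization S) S (Algebra.linearMap A (Localization S))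
      (Ideal.span {π i ^ e i})
  let β : (∀ i, A ⧸ Ideal.span {π i ^ e i}) →ₗ[A] ∀ i, Localization S ⧸ L i :=
    LinearMap.pi fun i => Submodule.toLocalizedQuotient' (Localization S) S
      (Algebra.linearMap A (Localization S)) (Ideal.span {π i ^ e i}) ∘ₗ LinearMap.proj i
  have hβ : IsLocalizedModule S β := inferInstance
  let m : M →ₗ[A] LocalizedModule S M := LocalizedModule.mkLinearMap S M
  let q : M →ₗ[A] ∀ i, Localization S ⧸ L i :=
    ((LinearMap.snd (Localization S) _ _ ∘ₗ φ.toLinearMap).restrictScalars A) ∘ₗ m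
  have hq : ∀ x, q x = (φ (m x)).2 := fun _ => rfl
  have : Module.FinitePresentation A M := Module.finitePresentation_of_finite A M
  obtain ⟨g, s, hg⟩ := Module.FinitePresentation.exists_lift_of_isLocalizedModule S β q
  replace hg : ∀ x, β (g x) = (s : A) • q x := fun x => LinearMap.congr_fun hg x
  have hφ : ∀ (a : A) x, φ (a • x) = a • φ x := fun a x =>
    (φ.toLinearMap.restrictScalars A).map_smul a x
  refine ⟨ι, hι, π, e, g, hπ, hπd, ?_, ?_⟩
  · intro x hx hgx
    obtain ⟨a, ha⟩ := (Submodule.mem_torsion_iff x).1 hx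
    have h2 : (φ (m x)).2 = 0 := by
      have h := hg x
      rw [hgx, map_zero] at h
      have hinj := IsLocalizedModule.smul_injective β s
      exact hinj (h.symm.trans (smul_zero s).symm)
    have h1 : (φ (m x)).1 = 0 := by
      have h : (a : A) • (φ (m x)).1 = 0 := by
        rw [← Prod.smul_fst, ← hφ, ← map_smul]
        erw [ha]
        rw [map_zero, map_zero, Prod.fst_zero]
      have hdom : IsDomain (Localization S) := IsLocalization.isDomain_localization hS0
      funext i
      have hi := congrFun h i
      rw [Pi.smul_apply, Algebra.smul_def, Pi.zero_apply, mul_eq_zero] at hi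
      refine hi.resolve_left fun h0 => nonZeroDivisors.ne_zero a.2 ?_
      exact (IsLocalization.to_map_eq_zero_iff _ hS0).1 h0
    have hx0 : m x = 0 := φ.map_eq_zero_iff.1 (Prod.ext h1 h2)
    obtain ⟨t, ht⟩ := (IsLocalizedModule.eq_zero_iff S m).1 hx0
    exact ⟨t, t.2, ht⟩
  · intro y
    obtain ⟨⟨x, t⟩, hxt⟩ := IsLocalizedModule.surj S m (φ.symm (0, β y))
    replace hxt : φ (m x) = (t : A) • ((0, β y) : _ × _) := by
      rw [← hxt]
      change φ ((t : A) • _) = _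
      rw [hφ, LinearEquiv.apply_symm_apply]
    -- the product of the `π i ^ e i` kills `y`, which makes a multiple of `x` torsion
    set c := ∏ i, π i ^ e i
    have hc0 : c ≠ 0 := Finset.prod_ne_zero_iff.2 fun i _ => pow_ne_zero _ (hπ i).ne_zero
    have hcy : c • y = 0 := prod_smul_eq_zero_of_quotient (fun i => π i ^ e i) y
    have hcx : m (c • x) = 0 := by
      refine φ.map_eq_zero_iff.1 ?_
      have h : c • ((0, β y) : (Fin r → Localization S) × (∀ i, Localization S ⧸ L i)) = 0 :=
        Prod.ext (smul_zero c) (by rw [Prod.smul_snd, ← map_smul, hcy, map_zero, Prod.snd_zero])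
      rw [map_smul, hφ, hxt, smul_comm]
      exact (congrArg _ h).trans (smul_zero _)
    obtain ⟨u, hu⟩ := (IsLocalizedModule.eq_zero_iff S m).1 hcx
    have hxtors : ((u : A) * c) • x = 0 := by
      rw [mul_smul]
      exact hu
    have hgx : β (g x) = β (((s : A) * t) • y) := by
      rw [hg, hq, hxt, Prod.smul_snd, map_smul, mul_smul]
    obtain ⟨v, hv⟩ := (IsLocalizedModule.eq_iff_exists S β).1 hgx
    refine ⟨v * (s * t), mul_mem v.2 (mul_mem s.2 t.2), (v : A) • x, ?_, ?_⟩
    · refine Submodule.smul_mem _ _ ((Submodule.mem_torsion_iff x).2 ⟨⟨(u : A) * c,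
        mul_mem (hS0 u.2) (mem_nonZeroDivisors_of_ne_zero hc0)⟩, hxtors⟩)
    · rw [map_smul, mul_smul]
      exact hv

/-- **Structure theorem** for finitely generated modules up to pseudo-isomorphism. The map is the
product of an embedding of the torsion-free quotient in a free module with finite cokernel, and of
a map which is an isomorphism on torsion after inverting the elements prime to an annihilator `d`
of the torsion. Its kernel and cokernel are annihilated by coprime elements. -/
theorem exists_isPseudoIso_elementary {A : Type u} (M : Type v) [CommRing A] [IsDomain A]
    [IsNoetherianRing A] [UniqueFactorizationMonoid A] [AddCommGroup M] [Module A M]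
    [Module.Finite A M] {ϖ : A} (hϖ : Prime ϖ) (hjac : ϖ ∈ Ideal.jacobson (⊥ : Ideal A))
    [IsPrincipalIdealRing (A ⧸ Ideal.span {ϖ})]
    (hfin : ∀ a b : A, IsRelPrime a b → Finite (A ⧸ Ideal.span {a, b})) :
    ∃ (r : ℕ) (ι : Type u) (_ : Fintype ι) (π : ι → A) (e : ι → ℕ)
      (f : M →ₗ[A] (Fin r → A) × ∀ i, A ⧸ Ideal.span {π i ^ e i}),
      (∀ i, Prime (π i)) ∧ IsPseudoIso f := by
  obtain ⟨d₀, hd₀, htors₀⟩ := exists_ne_zero_forall_torsion_smul_eq_zero A M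
  -- the factor `ϖ` makes `d` a nonunit even if there is no torsion
  let d := d₀ * ϖ
  have hd : d ≠ 0 := mul_ne_zero hd₀ hϖ.ne_zero
  have hd' : ¬ IsUnit d := fun h => hϖ.not_isUnit (isUnit_of_mul_isUnit_right h)
  have htors : ∀ x ∈ Submodule.torsion A M, d • x = 0 := fun x hx => by
    rw [show d = ϖ * d₀ from mul_comm _ _, mul_smul, htors₀ x hx, smul_zero]
  obtain ⟨ι, hι, π, e, g, hπ, hπd, hker, hcoker⟩ := exists_map_torsion (M := M) hd hd'
  have htf : ∀ (a : A) (n : M ⧸ Submodule.torsion A M), a • n = 0 → a = 0 ∨ n = 0 := by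
    intro a n han
    rw [or_iff_not_imp_left]
    intro ha
    have hn : n ∈ Submodule.torsion A (M ⧸ Submodule.torsion A M) :=
      (Submodule.mem_torsion_iff n).2 ⟨⟨a, mem_nonZeroDivisors_of_ne_zero ha⟩, han⟩
    rwa [Submodule.QuotientTorsion.torsion_eq_bot] at hn
  obtain ⟨r, h, hinj, hh⟩ := exists_injective_finite_quotient hϖ hjac hfin htf
  refine ⟨r, ι, hι, π, e, (h ∘ₗ (Submodule.torsion A M).mkQ).prod g, hπ, ?_, ?_⟩
  · refine finite_of_forall_exists_isRelPrime hfin ?_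
    rintro ⟨x, hx⟩
    replace hx : h (Submodule.Quotient.mk x) = 0 ∧ g x = 0 := Prod.mk_eq_zero.1 hx
    have hxT : x ∈ Submodule.torsion A M := by
      rw [← Submodule.Quotient.mk_eq_zero]
      exact hinj (hx.1.trans (map_zero h).symm)
    obtain ⟨s, hs, hsx⟩ := hker x hxT hx.2
    exact ⟨s, d, hs, Subtype.ext hsx, Subtype.ext (htors x hxT)⟩
  · -- the cokernel is an extension of the finite cokernel of `h` by the image `K` of the second
    -- factor, which is a quotient of the cokernel of `g` on the torsion submodule
    set R := LinearMap.range ((h ∘ₗ (Submodule.torsion A M).mkQ).prod g)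
    have hmemR : ∀ x, (h (Submodule.Quotient.mk x), g x) ∈ R := fun x => ⟨x, rfl⟩
    let κ : (∀ i, A ⧸ Ideal.span {π i ^ e i}) →ₗ[A] _ := R.mkQ ∘ₗ LinearMap.inr A (Fin r → A) _
    have hK : Finite (LinearMap.range κ) := by
      refine finite_of_forall_exists_isRelPrime hfin ?_
      rintro ⟨_, y, rfl⟩
      obtain ⟨s, hs, x, hx, hxy⟩ := hcoker y
      refine ⟨s, ∏ i, π i ^ e i, IsRelPrime.prod_right fun i _ =>
        IsRelPrime.pow_right fun c hcs hc => hs hcs (hc.trans (hπd i)), Subtype.ext ?_,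
        Subtype.ext ?_⟩
      · change s • κ y = 0
        rw [← map_smul, ← hxy]
        refine (Submodule.Quotient.mk_eq_zero R).2 ?_
        have := hmemR x
        rwa [(Submodule.Quotient.mk_eq_zero _).2 hx, map_zero] at this
      · change (∏ i, π i ^ e i) • κ y = 0
        rw [← map_smul, prod_smul_eq_zero_of_quotient fun i => π i ^ e i, map_zero]
    let δ : (Fin r → A) →ₗ[A] _ := (LinearMap.range κ).mkQ ∘ₗ R.mkQ ∘ₗ LinearMap.inl A (Fin r → A) _
    have hδ : LinearMap.range h ≤ LinearMap.ker δ := by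
      rintro _ ⟨n, rfl⟩
      obtain ⟨x, rfl⟩ := Submodule.Quotient.mk_surjective _ n
      refine (Submodule.Quotient.mk_eq_zero _).2 ⟨-g x, ?_⟩
      refine (Submodule.Quotient.eq R).2 ?_
      have : LinearMap.inr A (Fin r → A) _ (-g x) -
          LinearMap.inl A (Fin r → A) _ (h (Submodule.Quotient.mk x)) =
          -(h (Submodule.Quotient.mk x), g x) := by
        ext <;> simp
      rw [this]
      exact R.neg_mem (hmemR x)
    have hquot : Finite (_ ⧸ LinearMap.range κ) := by
      refine Finite.of_surjective ((LinearMap.range h).liftQ δ hδ) fun z => ?_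
      obtain ⟨z, rfl⟩ := Submodule.Quotient.mk_surjective _ z
      obtain ⟨⟨u, y⟩, rfl⟩ := Submodule.Quotient.mk_surjective _ z
      refine ⟨Submodule.Quotient.mk u, (Submodule.Quotient.eq _).2 ⟨-y, ?_⟩⟩
      refine (congrArg R.mkQ (?_ : _ = (u, 0) - (u, y))).trans (map_sub _ _ _)
      ext <;> simp
    exact @Finite.of_addSubgroup_quotient _ _ (LinearMap.range κ).toAddSubgroup hK hquot

/-! ### Power series over a complete discrete valuation ring -/

section PowerSeriesRing

open PowerSeries IsLocalRing

theorem ker_map_residue {O : Type*} [CommRing O] [IsDomain O] [IsDiscreteValuationRing O] {ϖ : O}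
    (hϖ : Irreducible ϖ) :
    RingHom.ker (PowerSeries.map (residue O)) = Ideal.span {(C ϖ : O⟦X⟧)} := by
  ext f
  rw [RingHom.mem_ker, Ideal.mem_span_singleton]
  have hcoeff : ∀ n, residue O (coeff n f) = 0 ↔ ϖ ∣ coeff n f := fun n => by
    rw [residue_eq_zero_iff, hϖ.maximalIdeal_eq, Ideal.mem_span_singleton]
  constructor
  · intro h
    have h' : ∀ n, ϖ ∣ coeff n f := fun n => by
      rw [← hcoeff, ← coeff_map, h, map_zero]
    choose g hg using h'
    refine ⟨PowerSeries.mk g, ?_⟩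
    ext n
    rw [coeff_C_mul, coeff_mk, hg]
  · rintro ⟨g, rfl⟩
    ext n
    rw [coeff_map, map_zero, hcoeff, coeff_C_mul]
    exact dvd_mul_right _ _

/-- Reduction of coefficients identifies `O⟦X⟧ / (ϖ)` with the power series over the residue
field. -/
noncomputable def quotientSpanUniformizerEquiv {O : Type*} [CommRing O] [IsDomain O]
    [IsDiscreteValuationRing O] {ϖ : O} (hϖ : Irreducible ϖ) :
    (O⟦X⟧ ⧸ Ideal.span {(C ϖ : O⟦X⟧)}) ≃+* (ResidueField O)⟦X⟧ :=
  (Ideal.quotEquivOfEq (ker_map_residue hϖ).symm).trans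
    (RingHom.quotientKerEquivOfSurjective
      (PowerSeries.map_surjective _ (residue_surjective (R := O))))

theorem prime_C_uniformizer {O : Type*} [CommRing O] [IsDomain O] [IsDiscreteValuationRing O]
    {ϖ : O} (hϖ : Irreducible ϖ) : Prime (C ϖ : O⟦X⟧) := by
  have h0 : (C ϖ : O⟦X⟧) ≠ 0 := fun h => hϖ.ne_zero (C_injective (h.trans (map_zero _).symm))
  rw [← Ideal.span_singleton_prime h0, ← ker_map_residue hϖ]
  exact RingHom.ker_isPrime _

theorem isPrincipalIdealRing_quotient_C_uniformizer {O : Type*} [CommRing O] [IsDomain O]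
    [IsDiscreteValuationRing O] {ϖ : O} (hϖ : Irreducible ϖ) :
    IsPrincipalIdealRing (O⟦X⟧ ⧸ Ideal.span {(C ϖ : O⟦X⟧)}) :=
  IsPrincipalIdealRing.of_surjective (quotientSpanUniformizerEquiv hϖ).symm.toRingHom
    (quotientSpanUniformizerEquiv hϖ).symm.surjective

theorem isDistinguishedAt_of_map_eq_X_pow {O : Type*} [CommRing O] [IsLocalRing O]
    {q : Polynomial O} (hq : q.Monic) {k : ℕ} (hmap : q.map (residue O) = Polynomial.X ^ k) :
    q.IsDistinguishedAt (maximalIdeal O) := by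
  have hdeg : q.natDegree = k := by
    rw [← hq.natDegree_map (residue O), hmap, Polynomial.natDegree_X_pow]
  refine ⟨⟨fun {n} hn => ?_⟩, hq⟩
  rw [← residue_eq_zero_iff, ← Polynomial.coeff_map, hmap, Polynomial.coeff_X_pow, if_neg]
  omega

/-- A monic factor of a distinguished polynomial over a local ring is distinguished. -/
theorem isDistinguishedAt_of_monic_of_dvd {O : Type*} [CommRing O] [IsLocalRing O]
    {D q : Polynomial O} (hD : D.IsDistinguishedAt (maximalIdeal O)) (hq : q.Monic) (hqD : q ∣ D) :
    q.IsDistinguishedAt (maximalIdeal O) := by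
  have hdvd : q.map (residue O) ∣ Polynomial.X ^ D.natDegree := by
    have h : D.map (residue O) = Polynomial.X ^ D.natDegree := hD.map_eq_X_pow
    rw [← h]
    exact Polynomial.map_dvd _ hqD
  obtain ⟨k, -, hk⟩ := (dvd_prime_pow Polynomial.prime_X _).1 hdvd
  exact isDistinguishedAt_of_map_eq_X_pow hq
    (Polynomial.eq_of_monic_of_associated (hq.map _) (Polynomial.monic_X_pow k) hk)

/-- A distinguished prime polynomial is prime as a power series, because `O[X] / (q)` and
`O⟦X⟧ / (q)` agree. -/
theorem prime_coe_of_isDistinguishedAt {O : Type*} [CommRing O] [IsDomain O] [IsLocalRing O]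
    [IsAdicComplete (maximalIdeal O) O] {q : Polynomial O}
    (hq : q.IsDistinguishedAt (maximalIdeal O)) (hprime : Prime q) : Prime (q : O⟦X⟧) := by
  have h0 : (q : O⟦X⟧) ≠ 0 := fun h =>
    hprime.ne_zero (Polynomial.coe_injective O (by simpa using h))
  rw [← Ideal.span_singleton_prime h0, ← Ideal.Quotient.isDomain_iff_prime]
  have : (Ideal.span {q}).IsPrime := (Ideal.span_singleton_prime hprime.ne_zero).2 hprime
  exact (hq.algEquivQuotient).symm.toMulEquiv.isDomain (Polynomial O ⧸ Ideal.span {q})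

/-- By Weierstrass preparation, every nonzero prime of `O⟦X⟧` contains `ϖ` or a distinguished
polynomial which is a prime element. -/
theorem exists_mem_of_isPrime_powerSeries {O : Type*} [CommRing O] [IsDomain O]
    [IsDiscreteValuationRing O] [IsAdicComplete (maximalIdeal O) O] {ϖ : O} (hϖ : Irreducible ϖ)
    (Q : Ideal O⟦X⟧) [hQ : Q.IsPrime] (hQ0 : Q ≠ ⊥) :
    C ϖ ∈ Q ∨ ∃ q : Polynomial O, q.IsDistinguishedAt (maximalIdeal O) ∧ Prime (q : O⟦X⟧) ∧
      (q : O⟦X⟧) ∈ Q := by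
  obtain ⟨f, hfQ, hf0⟩ := Submodule.exists_mem_ne_zero_of_ne_bot hQ0
  have hfm : FiniteMultiplicity (C ϖ) f :=
    FiniteMultiplicity.of_not_isUnit (prime_C_uniformizer hϖ).not_isUnit hf0
  obtain ⟨g, hfg, hg⟩ := hfm.exists_eq_pow_mul_and_not_dvd
  rw [hfg] at hfQ
  refine (hQ.mem_or_mem hfQ).imp (fun h => hQ.mem_of_pow_mem _ h) fun hgQ => ?_
  have hgmap : g.map (residue O) ≠ 0 := fun h => by
    rw [← RingHom.mem_ker, ker_map_residue hϖ, Ideal.mem_span_singleton] at h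
    exact hg h
  have hD := isDistinguishedAt_weierstrassDistinguished hgmap
  set D := g.weierstrassDistinguished hgmap
  have hDQ : (D : O⟦X⟧) ∈ Q := by
    rw [eq_weierstrassDistinguished_mul_weierstrassUnit hgmap] at hgQ
    exact (Ideal.mul_unit_mem_iff_mem Q (isUnit_weierstrassUnit hgmap)).1 hgQ
  let P : Ideal (Polynomial O) := Q.comap (Polynomial.coeToPowerSeries.ringHom)
  have hP : P.IsPrime := inferInstance
  obtain ⟨s, hs, u, hsu⟩ := UniqueFactorizationMonoid.exists_prime_factors D hD.monic.ne_zero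
  have hsP : s.prod ∈ P := by
    rw [← Ideal.mul_unit_mem_iff_mem P u.isUnit, hsu]
    exact hDQ
  obtain ⟨q, hqs, hqP⟩ := (Ideal.IsPrime.multiset_prod_mem_iff_exists_mem hP s).1 hsP
  have hqD : q ∣ D := (Multiset.dvd_prod hqs).trans ⟨u, hsu.symm⟩
  obtain ⟨w, hw⟩ := hqD
  have hlead : q.leadingCoeff * w.leadingCoeff = 1 := by
    rw [← Polynomial.leadingCoeff_mul, ← hw, hD.monic.leadingCoeff]
  -- divide `q` by its leading coefficient, which is a unit
  let q' := q * Polynomial.C w.leadingCoeff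
  have hunit : IsUnit (Polynomial.C w.leadingCoeff) :=
    Polynomial.isUnit_C.2 (IsUnit.of_mul_eq_one_right _ hlead)
  have hassoc : Associated q q' := ⟨hunit.unit, rfl⟩
  have hmonic : q'.Monic := by
    rw [Polynomial.Monic, Polynomial.leadingCoeff_mul, Polynomial.leadingCoeff_C, hlead]
  have hdist := isDistinguishedAt_of_monic_of_dvd hD hmonic
    (hassoc.symm.dvd.trans ⟨w, hw⟩)
  exact ⟨q', hdist, prime_coe_of_isDistinguishedAt hdist (hassoc.prime (hs q hqs)),
    (Ideal.mul_mem_right _ P hqP : q' ∈ P)⟩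

theorem uniqueFactorizationMonoid_powerSeries {O : Type*} [CommRing O] [IsDomain O]
    [IsDiscreteValuationRing O] [IsAdicComplete (maximalIdeal O) O] :
    UniqueFactorizationMonoid O⟦X⟧ := by
  obtain ⟨ϖ, hϖ⟩ := IsDiscreteValuationRing.exists_irreducible O
  refine UniqueFactorizationMonoid.iff_exists_prime_mem_of_isPrime.2 fun Q hQ0 hQ => ?_
  rcases exists_mem_of_isPrime_powerSeries hϖ Q hQ0 with h | ⟨q, -, hq, hqQ⟩
  · exact ⟨_, h, prime_C_uniformizer hϖ⟩
  · exact ⟨_, hqQ, hq⟩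

/-- A prime element of `O⟦X⟧` is associated to `ϖ` or to a distinguished polynomial. -/
theorem associated_of_prime_powerSeries {O : Type*} [CommRing O] [IsDomain O]
    [IsDiscreteValuationRing O] [IsAdicComplete (maximalIdeal O) O] {ϖ : O} (hϖ : Irreducible ϖ)
    {π : O⟦X⟧} (hπ : Prime π) :
    Associated π (C ϖ) ∨ ∃ q : Polynomial O, q.IsDistinguishedAt (maximalIdeal O) ∧
      Associated π q := by
  have hQ : (Ideal.span {π}).IsPrime := (Ideal.span_singleton_prime hπ.ne_zero).2 hπ
  rcases exists_mem_of_isPrime_powerSeries hϖ (Ideal.span {π}) (by simpa using hπ.ne_zero) with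
    h | ⟨q, hq, hqp, h⟩
  · exact Or.inl (hπ.associated_of_dvd (prime_C_uniformizer hϖ) (Ideal.mem_span_singleton.1 h))
  · exact Or.inr ⟨q, hq, hπ.associated_of_dvd hqp (Ideal.mem_span_singleton.1 h)⟩

/-- A prime of `O⟦X⟧` containing a distinguished polynomial `q` and an element not divisible
by `q` contains `ϖ`: the ring `O⟦X⟧ / (q) = O[X] / (q)` is integral over `O`. -/
theorem C_uniformizer_mem_of_isDistinguishedAt {O : Type*} [CommRing O] [IsDomain O]
    [IsDiscreteValuationRing O] [IsAdicComplete (maximalIdeal O) O] {ϖ : O} (hϖ : Irreducible ϖ)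
    (Q : Ideal O⟦X⟧) [hQ : Q.IsPrime] {q : Polynomial O}
    (hq : q.IsDistinguishedAt (maximalIdeal O)) (hqp : Prime (q : O⟦X⟧)) (hqQ : (q : O⟦X⟧) ∈ Q)
    {c : O⟦X⟧} (hcQ : c ∈ Q) (hc : ¬ (q : O⟦X⟧) ∣ c) : C ϖ ∈ Q := by
  have hqprime : (Ideal.span {(q : O⟦X⟧)}).IsPrime := (Ideal.span_singleton_prime hqp.ne_zero).2 hqp
  have hint : IsIntegral O (Ideal.Quotient.mk (Ideal.span {(q : O⟦X⟧)}) c) := by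
    have := hq.monic.finite_quotient
    rw [← isIntegral_algEquiv hq.algEquivQuotient.symm]
    exact IsIntegral.of_finite O _
  have hne : Ideal.comap (algebraMap O (O⟦X⟧ ⧸ Ideal.span {(q : O⟦X⟧)}))
      (Q.map (Ideal.Quotient.mk _)) ≠ ⊥ := by
    refine Ideal.comap_ne_bot_of_integral_mem ?_ (Ideal.mem_map_of_mem _ hcQ) hint
    rw [Ne, Ideal.Quotient.eq_zero_iff_mem, Ideal.mem_span_singleton]
    exact hc
  obtain ⟨a, ha, ha0⟩ := Submodule.exists_mem_ne_zero_of_ne_bot hne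
  have haQ : C a ∈ Q := by
    have h : Ideal.Quotient.mk (Ideal.span {(q : O⟦X⟧)}) (C a) ∈ Q.map (Ideal.Quotient.mk _) := ha
    rw [Ideal.mem_map_iff_of_surjective _ Ideal.Quotient.mk_surjective] at h
    obtain ⟨y, hy, hya⟩ := h
    have h := Ideal.mem_span_singleton'.1 (Ideal.Quotient.eq.1 hya.symm)
    obtain ⟨z, hz⟩ := h
    rw [← sub_add_cancel (C a) y, ← hz]
    exact Q.add_mem (Q.mul_mem_left _ hqQ) hy
  obtain ⟨n, u, rfl⟩ := IsDiscreteValuationRing.eq_unit_mul_pow_irreducible ha0 hϖ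
  rw [map_mul, map_pow] at haQ
  refine hQ.mem_of_pow_mem n ((Ideal.unit_mul_mem_iff_mem Q ?_).1 haQ)
  exact u.isUnit.map (C : O →+* O⟦X⟧)

/-- A prime of `O⟦X⟧` containing `ϖ` and an element not divisible by `ϖ` is the maximal ideal. -/
theorem eq_maximalIdeal_of_C_uniformizer_mem {O : Type*} [CommRing O] [IsDomain O]
    [IsDiscreteValuationRing O] {ϖ : O} (hϖ : Irreducible ϖ)
    (Q : Ideal O⟦X⟧) [hQ : Q.IsPrime] (hϖQ : C ϖ ∈ Q)
    {c : O⟦X⟧} (hcQ : c ∈ Q) (hc : ¬ C ϖ ∣ c) : Q = maximalIdeal O⟦X⟧ := by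
  have hker : RingHom.ker (PowerSeries.map (residue O)) ≤ Q := by
    rw [ker_map_residue hϖ, Ideal.span_singleton_le_iff_mem]
    exact hϖQ
  let Q' : Ideal (ResidueField O)⟦X⟧ := Q.map (PowerSeries.map (residue O))
  have hsurj := PowerSeries.map_surjective _ (residue_surjective (R := O))
  have hQ' : Q'.IsPrime := Ideal.map_isPrime_of_surjective hsurj hker
  have hQ'0 : Q' ≠ ⊥ := fun h => by
    have : PowerSeries.map (residue O) c ∈ Q' := Ideal.mem_map_of_mem _ hcQ
    rw [h, Ideal.mem_bot, ← RingHom.mem_ker, ker_map_residue hϖ, Ideal.mem_span_singleton] at this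
    exact hc this
  have hmax : Q'.IsMaximal := hQ'.isMaximal hQ'0
  have hcomap : Q'.comap (PowerSeries.map (residue O)) = Q := by
    rw [Ideal.comap_map_of_surjective' _ hsurj, sup_eq_left]
    exact hker
  rw [← hcomap]
  exact eq_maximalIdeal (Ideal.comap_isMaximal_of_surjective _ hsurj)

theorem finite_quotient_maximalIdeal_powerSeries {O : Type*} [CommRing O] [IsLocalRing O]
    [Finite (ResidueField O)] : Finite (O⟦X⟧ ⧸ maximalIdeal O⟦X⟧) := by
  have hle : maximalIdeal O ≤ (maximalIdeal O⟦X⟧).comap C := fun x hx => by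
    rw [Ideal.mem_comap, mem_maximalIdeal, mem_nonunits_iff, isUnit_iff_constantCoeff,
      constantCoeff_C]
    exact hx
  have : Finite (O ⧸ maximalIdeal O) := inferInstanceAs (Finite (ResidueField O))
  refine Finite.of_surjective (Ideal.quotientMap (maximalIdeal O⟦X⟧) C hle) fun y => ?_
  obtain ⟨f, rfl⟩ := Ideal.Quotient.mk_surjective y
  refine ⟨Ideal.Quotient.mk _ (constantCoeff f), ?_⟩
  refine Ideal.Quotient.eq.2 ?_
  rw [mem_maximalIdeal, mem_nonunits_iff, isUnit_iff_constantCoeff]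
  simp

/-- Two coprime elements of `O⟦X⟧` generate an ideal of finite index: the only prime containing
both is the maximal ideal, whose powers have finite index. -/
theorem finite_quotient_span_pair_powerSeries {O : Type*} [CommRing O] [IsDomain O]
    [IsDiscreteValuationRing O] [IsAdicComplete (maximalIdeal O) O] [Finite (ResidueField O)]
    (a b : O⟦X⟧) (hab : IsRelPrime a b) : Finite (O⟦X⟧ ⧸ Ideal.span {a, b}) := by
  obtain ⟨ϖ, hϖ⟩ := IsDiscreteValuationRing.exists_irreducible O
  have hndvd : ∀ c : O⟦X⟧, Prime c → ∃ x ∈ Ideal.span {a, b}, ¬ c ∣ x := by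
    intro c hc
    by_contra! h
    exact hc.not_isUnit (hab (h a (Ideal.subset_span (by simp)))
      (h b (Ideal.subset_span (by simp))))
  have hprimes : ∀ Q : Ideal O⟦X⟧, Q.IsPrime → Ideal.span {a, b} ≤ Q → Q = maximalIdeal O⟦X⟧ := by
    intro Q hQ hle
    have hQ0 : Q ≠ ⊥ := by
      rintro rfl
      obtain ⟨x, hx, hxdvd⟩ := hndvd _ (prime_C_uniformizer hϖ)
      rw [(Ideal.mem_bot).1 (hle hx)] at hxdvd
      exact hxdvd (dvd_zero _)
    have hϖQ : C ϖ ∈ Q := by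
      rcases exists_mem_of_isPrime_powerSeries hϖ Q hQ0 with h | ⟨q, hq, hqp, hqQ⟩
      · exact h
      · obtain ⟨x, hx, hxdvd⟩ := hndvd _ hqp
        exact C_uniformizer_mem_of_isDistinguishedAt hϖ Q hq hqp hqQ (hle hx) hxdvd
    obtain ⟨x, hx, hxdvd⟩ := hndvd _ (prime_C_uniformizer hϖ)
    exact eq_maximalIdeal_of_C_uniformizer_mem hϖ Q hϖQ (hle hx) hxdvd
  have hrad : maximalIdeal O⟦X⟧ ≤ (Ideal.span {a, b}).radical := by
    rw [Ideal.radical_eq_sInf]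
    exact le_sInf fun Q hQ => (hprimes Q hQ.2 hQ.1).ge
  obtain ⟨n, hn⟩ := (Ideal.span {a, b}).exists_radical_pow_le_of_fg (IsNoetherian.noetherian _)
  have := finite_quotient_maximalIdeal_powerSeries (O := O)
  have := Ideal.finite_quotient_pow
    (IsNoetherian.noetherian (maximalIdeal O⟦X⟧)) n
  exact Finite.of_surjective _ (Ideal.Quotient.factor_surjective
    ((Ideal.pow_right_mono hrad n).trans hn))

end PowerSeriesRing

/-! ### The finite layers of a group isomorphic to `ℤ_p` -/

section Layers

variable {p : ℕ} [Fact p.Prime] {Γ : Type*} [CommGroup Γ] [TopologicalSpace Γ]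

theorem mem_powSubgroup_iff (e : Γ ≃ₜ* Multiplicative ℤ_[p]) (n : ℕ) (x : Γ) :
    x ∈ powSubgroup p Γ n ↔ (p : ℤ_[p]) ^ n ∣ (e x).toAdd := by
  constructor
  · rintro ⟨y, rfl⟩
    exact ⟨(e y).toAdd, by simp [powMonoidHom_apply]⟩
  · rintro ⟨w, hw⟩
    refine ⟨e.symm (Multiplicative.ofAdd w), e.injective ?_⟩
    apply Multiplicative.toAdd.injective
    simp [powMonoidHom_apply, hw]

/-- A topological group isomorphic to `ℤ_p` is topologically generated by one element. -/
theorem exists_dense_zpowers (e : Γ ≃ₜ* Multiplicative ℤ_[p]) :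
    ∃ γ : Γ, Dense (Subgroup.zpowers γ : Set Γ) := by
  refine ⟨e.symm (Multiplicative.ofAdd 1), ?_⟩
  have h : DenseRange fun k : ℤ => e.symm (Multiplicative.ofAdd (k : ℤ_[p])) :=
    (e.symm.surjective.denseRange).comp PadicInt.denseRange_intCast e.symm.continuous
  refine h.mono ?_
  rintro _ ⟨k, rfl⟩
  exact ⟨k, by simp [← map_zpow, ← ofAdd_zsmul]⟩

theorem isOpen_powSubgroup (e : Γ ≃ₜ* Multiplicative ℤ_[p]) (n : ℕ) :
    IsOpen (powSubgroup p Γ n : Set Γ) := by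
  have h : (powSubgroup p Γ n : Set Γ) =
      (fun x => (e x).toAdd) ⁻¹' Metric.closedBall 0 ((p : ℝ) ^ (-n : ℤ)) := by
    ext x
    rw [SetLike.mem_coe, mem_powSubgroup_iff e, Set.mem_preimage, mem_closedBall_zero_iff,
      PadicInt.norm_le_pow_iff_mem_span_pow, Ideal.mem_span_singleton]
  rw [h]
  have hp : (0 : ℝ) < p := by exact_mod_cast (Fact.out : p.Prime).pos
  exact (IsUltrametricDist.isOpen_closedBall _ (zpow_pos hp _).ne').preimage
    (continuous_toAdd.comp e.continuous)

theorem exists_zpow_eq_mk [IsTopologicalGroup Γ] (e : Γ ≃ₜ* Multiplicative ℤ_[p]) {γ : Γ}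
    (hγ : Dense (Subgroup.zpowers γ : Set Γ)) (n : ℕ) (x : Γ ⧸ powSubgroup p Γ n) :
    ∃ k : ℤ, (γ : Γ ⧸ powSubgroup p Γ n) ^ k = x := by
  obtain ⟨g, rfl⟩ := QuotientGroup.mk_surjective x
  have hopen : IsOpen ((fun y => g⁻¹ * y) ⁻¹' (powSubgroup p Γ n : Set Γ)) :=
    (isOpen_powSubgroup e n).preimage (continuous_const_mul _)
  obtain ⟨_, ⟨k, rfl⟩, hy⟩ := hγ.exists_mem_open hopen ⟨g, by simp [one_mem]⟩
  exact ⟨k, (QuotientGroup.eq.2 hy).symm⟩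

/-- The layer `Γ / Γ ^ (p ^ n)` is cyclic of order `p ^ n`, generated by any topological
generator of `Γ`. -/
theorem orderOf_mk_powSubgroup [IsTopologicalGroup Γ] (e : Γ ≃ₜ* Multiplicative ℤ_[p]) {γ : Γ}
    (hγ : Dense (Subgroup.zpowers γ : Set Γ)) (n : ℕ) :
    orderOf (γ : Γ ⧸ powSubgroup p Γ n) = p ^ n := by
  -- the image of a topological generator in `ℤ_p` is a unit, as it generates the layer of order `p`
  have hunit : IsUnit (e γ).toAdd := by
    obtain ⟨k, hk⟩ := exists_zpow_eq_mk e hγ 1 (e.symm (Multiplicative.ofAdd 1))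
    by_contra hnu
    have hdvd : (p : ℤ_[p]) ∣ (e γ).toAdd := by
      rw [← Ideal.mem_span_singleton, ← PadicInt.maximalIdeal_eq_span_p]
      exact hnu
    rw [← QuotientGroup.mk_zpow, QuotientGroup.eq, mem_powSubgroup_iff e, pow_one] at hk
    have h1 : (p : ℤ_[p]) ∣ 1 := by
      have hk' : (p : ℤ_[p]) ∣ -(k * (e γ).toAdd) + 1 := by simpa using hk
      exact (dvd_add_right ((hdvd.mul_left _).neg_right)).1 hk'
    exact PadicInt.prime_p.not_isUnit (isUnit_of_dvd_one h1)
  refine Nat.dvd_antisymm (orderOf_dvd_of_pow_eq_one ?_) ?_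
  · rw [← QuotientGroup.mk_pow, QuotientGroup.eq_one_iff]
    exact ⟨γ, rfl⟩
  · have h := pow_orderOf_eq_one (γ : Γ ⧸ powSubgroup p Γ n)
    rw [← QuotientGroup.mk_pow, QuotientGroup.eq_one_iff, mem_powSubgroup_iff e, map_pow,
      toAdd_pow, nsmul_eq_mul, hunit.dvd_mul_right] at h
    exact_mod_cast (PadicInt.pow_p_dvd_int_iff n (orderOf (γ : Γ ⧸ powSubgroup p Γ n) : ℤ)).1
      (by exact_mod_cast h)

end Layers

/-! ### Group rings of the layers as quotients of the power series ring -/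

section GroupRing

open PowerSeries IsLocalRing

/-- The polynomial `(1 + X) ^ N - 1`; for `N = p ^ n` it generates the kernel of
`O⟦X⟧ → O[Γ / Γ ^ (p ^ n)]`. -/
noncomputable def layerPoly (O : Type*) [CommRing O] (N : ℕ) : Polynomial O :=
  (Polynomial.X + 1) ^ N - 1

theorem monic_layerPoly {O : Type*} [CommRing O] [Nontrivial O] {N : ℕ} (hN : N ≠ 0) :
    (layerPoly O N).Monic ∧ (layerPoly O N).natDegree = N := by
  have hmonic : (Polynomial.X + 1 : Polynomial O).Monic := by
    simpa using Polynomial.monic_X_add_C (1 : O)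
  have hdeg : ((Polynomial.X + 1 : Polynomial O) ^ N).natDegree = N := by
    rw [hmonic.natDegree_pow]
    simpa using congrArg (N * ·) (Polynomial.natDegree_X_add_C (1 : O))
  have hlt : (1 : Polynomial O).degree < ((Polynomial.X + 1 : Polynomial O) ^ N).degree := by
    rw [Polynomial.degree_eq_natDegree (hmonic.pow N).ne_zero, hdeg, Polynomial.degree_one]
    exact_mod_cast Nat.pos_of_ne_zero hN
  exact ⟨(hmonic.pow N).sub_of_left hlt,
    by rw [layerPoly, Polynomial.natDegree_sub_eq_left_of_natDegree_lt (by
      rw [hdeg, Polynomial.natDegree_one]; exact Nat.pos_of_ne_zero hN), hdeg]⟩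

theorem isDistinguishedAt_layerPoly {O : Type*} [CommRing O] [IsLocalRing O] (p : ℕ)
    [Fact p.Prime] [CharP (ResidueField O) p] (n : ℕ) :
    (layerPoly O (p ^ n)).IsDistinguishedAt (maximalIdeal O) := by
  obtain ⟨hmonic, hdeg⟩ := monic_layerPoly (O := O) (pow_ne_zero n (Fact.out : p.Prime).ne_zero)
  refine isDistinguishedAt_of_map_eq_X_pow hmonic (k := p ^ n) ?_
  simp only [layerPoly, Polynomial.map_sub, Polynomial.map_pow, Polynomial.map_add,
    Polynomial.map_X, Polynomial.map_one]
  rw [add_pow_char_pow, one_pow, add_sub_cancel_right]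

/-- Substituting `γ - 1` for `X`, from `O[X]` to a group ring. -/
noncomputable def evalGroupRing (O : Type*) [CommRing O] {G : Type*} [CommGroup G] (γ : G) :
    Polynomial O →ₐ[O] MonoidAlgebra O G :=
  Polynomial.aeval (MonoidAlgebra.of O G γ - 1)

theorem evalGroupRing_X_add_one_pow {O : Type*} [CommRing O] {G : Type*} [CommGroup G] (γ : G)
    (N : ℕ) : evalGroupRing O γ ((Polynomial.X + 1) ^ N) = MonoidAlgebra.of O G (γ ^ N) := by
  rw [map_pow, map_add, map_one, evalGroupRing, Polynomial.aeval_X, sub_add_cancel, map_pow]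

theorem evalGroupRing_layerPoly {O : Type*} [CommRing O] {G : Type*} [CommGroup G] {γ : G}
    {N : ℕ} (hγ : γ ^ N = 1) : evalGroupRing O γ (layerPoly O N) = 0 := by
  rw [layerPoly, map_sub, evalGroupRing_X_add_one_pow, hγ, map_one, map_one, sub_self]

theorem evalGroupRing_surjective {O : Type*} [CommRing O] {G : Type*} [CommGroup G] {γ : G}
    (h : ∀ x : G, ∃ k : ℕ, γ ^ k = x) : Function.Surjective (evalGroupRing O γ) := by
  intro y
  induction y using MonoidAlgebra.induction_on with
  | of x =>
    obtain ⟨k, rfl⟩ := h x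
    exact ⟨_, evalGroupRing_X_add_one_pow γ k⟩
  | add x y hx hy =>
    obtain ⟨a, rfl⟩ := hx
    obtain ⟨b, rfl⟩ := hy
    exact ⟨a + b, map_add _ _ _⟩
  | smul r x hx =>
    obtain ⟨a, rfl⟩ := hx
    exact ⟨r • a, map_smul _ _ _⟩

/-- The powers `1, γ, …, γ ^ (N - 1)` of an element of order `N` are linearly independent in the
group ring. -/
theorem eq_zero_of_evalGroupRing_eq_zero {O : Type*} [CommRing O] {G : Type*} [CommGroup G] {γ : G}
    {r : Polynomial O} (hr : r.natDegree < orderOf γ) (h : evalGroupRing O γ r = 0) : r = 0 := by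
  -- rewrite `r` as a polynomial in `X + 1`
  set r' := r.comp (Polynomial.X - 1) with hr'
  have hcomp : r'.comp (Polynomial.X + 1) = r := by
    rw [hr', Polynomial.comp_assoc]
    simp
  have hdeg : r'.natDegree < orderOf γ := by
    refine lt_of_le_of_lt (Polynomial.natDegree_comp_le.trans ?_) hr
    have : (Polynomial.X - 1 : Polynomial O).natDegree ≤ 1 := by
      simpa using Polynomial.natDegree_X_sub_C_le (1 : O)
    simpa using Nat.mul_le_mul_left r.natDegree this
  have hsum : ∑ i ∈ Finset.range (orderOf γ),
      r'.coeff i • MonoidAlgebra.single (γ ^ i) (1 : O) = 0 := by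
    rw [← h, ← hcomp, evalGroupRing, Polynomial.aeval_comp, map_add, Polynomial.aeval_X, map_one,
      sub_add_cancel, Polynomial.aeval_eq_sum_range' hdeg]
    refine Finset.sum_congr rfl fun i _ => ?_
    rw [← map_pow, MonoidAlgebra.of_apply]
  have hr0 : r' = 0 := by
    ext j
    by_cases hj : j < orderOf γ
    · have h1 := congrArg (fun x : MonoidAlgebra O G => x.coeff (γ ^ j)) hsum
      simp only [MonoidAlgebra.coeff_sum, MonoidAlgebra.coeff_smul, MonoidAlgebra.coeff_single,
        Finsupp.finsetSum_apply, Finsupp.smul_apply, MonoidAlgebra.coeff_zero,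
        Finsupp.zero_apply] at h1
      rw [Finset.sum_eq_single_of_mem j (Finset.mem_range.2 hj), Finsupp.single_eq_same,
        smul_eq_mul, mul_one] at h1
      · exact h1
      · intro i hi hij
        rw [Finsupp.single_eq_of_ne, smul_zero]
        exact fun h => hij (pow_injOn_Iio_orderOf (Finset.mem_range.1 hi) hj h.symm)
    · rw [Polynomial.coeff_eq_zero_of_natDegree_lt (by omega), Polynomial.coeff_zero]
  rw [← hcomp, hr0, Polynomial.zero_comp]
end GroupRing

section PowerSeriesToLayer

open PowerSeries IsLocalRing

theorem evalGroupRing_eq_zero_of_mem_span {O : Type*} [CommRing O] {G : Type*} [CommGroup G]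
    {γ : G} {q : Polynomial O} (h : evalGroupRing O γ q = 0) (a : Polynomial O)
    (ha : a ∈ Ideal.span {q}) : evalGroupRing O γ a = 0 := by
  obtain ⟨b, rfl⟩ := Ideal.mem_span_singleton'.1 ha
  rw [map_mul, h, mul_zero]

/-- Substituting `γ - 1` for `X`, from `O⟦X⟧` to a group ring, if a distinguished polynomial `q`
vanishes at `γ - 1`: a power series is reduced to a polynomial modulo `q` by Weierstrass
division. -/
noncomputable def powerSeriesEval {O : Type*} [CommRing O] [IsLocalRing O]
    [IsAdicComplete (maximalIdeal O) O] {G : Type*} [CommGroup G] (γ : G) {q : Polynomial O}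
    (hq : q.IsDistinguishedAt (maximalIdeal O)) (h : evalGroupRing O γ q = 0) :
    O⟦X⟧ →ₐ[O] MonoidAlgebra O G :=
  ((Ideal.Quotient.liftₐ (Ideal.span {q}) (evalGroupRing O γ)
      (evalGroupRing_eq_zero_of_mem_span h)).comp
    (hq.algEquivQuotient.symm : _ →ₐ[O] (Polynomial O ⧸ Ideal.span {q}))).comp
      (Ideal.Quotient.mkₐ O (Ideal.span {(q : O⟦X⟧)}))

theorem powerSeriesEval_coe {O : Type*} [CommRing O] [IsLocalRing O]
    [IsAdicComplete (maximalIdeal O) O] {G : Type*} [CommGroup G] (γ : G) {q : Polynomial O}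
    (hq : q.IsDistinguishedAt (maximalIdeal O)) (h : evalGroupRing O γ q = 0)
    (r : Polynomial O) : powerSeriesEval γ hq h (r : O⟦X⟧) = evalGroupRing O γ r := by
  have h1 : Ideal.Quotient.mk (Ideal.span {(q : O⟦X⟧)}) (r : O⟦X⟧) =
      hq.algEquivQuotient (Ideal.Quotient.mk _ r) := rfl
  have h2 : hq.algEquivQuotient.symm (Ideal.Quotient.mk (Ideal.span {(q : O⟦X⟧)}) (r : O⟦X⟧)) =
      Ideal.Quotient.mk _ r := by
    rw [h1, AlgEquiv.symm_apply_apply]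
  exact congrArg (Ideal.Quotient.liftₐ (Ideal.span {q}) (evalGroupRing O γ)
    (evalGroupRing_eq_zero_of_mem_span h)) h2

theorem exists_polynomial_sub_mem_span {O : Type*} [CommRing O] [IsLocalRing O]
    [IsAdicComplete (maximalIdeal O) O] {q : Polynomial O}
    (hq : q.IsDistinguishedAt (maximalIdeal O)) (f : O⟦X⟧) :
    ∃ r : Polynomial O, f - r ∈ Ideal.span {(q : O⟦X⟧)} := by
  obtain ⟨z, hz⟩ := hq.algEquivQuotient.surjective (Ideal.Quotient.mk _ f)
  obtain ⟨r, rfl⟩ := Ideal.Quotient.mk_surjective z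
  exact ⟨r, Ideal.Quotient.eq.1 hz.symm⟩

theorem powerSeriesEval_surjective {O : Type*} [CommRing O] [IsLocalRing O]
    [IsAdicComplete (maximalIdeal O) O] {G : Type*} [CommGroup G] {γ : G} {q : Polynomial O}
    (hq : q.IsDistinguishedAt (maximalIdeal O)) (h : evalGroupRing O γ q = 0)
    (hγ : ∀ x : G, ∃ k : ℕ, γ ^ k = x) : Function.Surjective (powerSeriesEval γ hq h) := by
  intro y
  obtain ⟨r, rfl⟩ := evalGroupRing_surjective hγ y
  exact ⟨r, powerSeriesEval_coe γ hq h r⟩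

theorem ker_powerSeriesEval {O : Type*} [CommRing O] [IsLocalRing O]
    [IsAdicComplete (maximalIdeal O) O] {G : Type*} [CommGroup G] {γ : G} {q : Polynomial O}
    (hq : q.IsDistinguishedAt (maximalIdeal O)) (h : evalGroupRing O γ q = 0)
    (hdeg : q.natDegree = orderOf γ) (f : O⟦X⟧) :
    powerSeriesEval γ hq h f = 0 ↔ f ∈ Ideal.span {(q : O⟦X⟧)} := by
  have hq0 : powerSeriesEval γ hq h (q : O⟦X⟧) = 0 := (powerSeriesEval_coe γ hq h q).trans h
  have hspan : ∀ g ∈ Ideal.span {(q : O⟦X⟧)}, powerSeriesEval γ hq h g = 0 := by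
    intro g hg
    obtain ⟨b, rfl⟩ := Ideal.mem_span_singleton'.1 hg
    rw [map_mul, hq0, mul_zero]
  refine ⟨fun hf => ?_, hspan f⟩
  obtain ⟨r, hr⟩ := exists_polynomial_sub_mem_span hq f
  have hr0 : evalGroupRing O γ r = 0 := by
    have := hspan _ hr
    rwa [map_sub, hf, zero_sub, neg_eq_zero, powerSeriesEval_coe] at this
  -- the remainder of `r` modulo `q` has degree less than the order of `γ`, hence vanishes
  have hmod : r %ₘ q = 0 := by
    by_cases hq1 : q = 1
    · rw [hq1, Polynomial.modByMonic_one]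
    refine eq_zero_of_evalGroupRing_eq_zero (γ := γ) ?_ ?_
    · rw [← hdeg]
      exact Polynomial.natDegree_modByMonic_lt r hq.monic hq1
    · rw [Polynomial.modByMonic_eq_sub_mul_div, map_sub, map_mul, h, hr0, zero_mul, sub_zero]
  rw [← sub_add_cancel f r]
  refine Ideal.add_mem _ hr (Ideal.mem_span_singleton.2 ?_)
  obtain ⟨w, hw⟩ := (Polynomial.modByMonic_eq_zero_iff_dvd hq.monic).1 hmod
  exact ⟨w, by rw [hw, Polynomial.coe_mul]⟩

end PowerSeriesToLayer

/-! ### Completeness of the power series ring -/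

section Completeness

open PowerSeries IsLocalRing

/-- Together with its converse `mem_maximalIdeal_pow_of_coeff_mem`, this describes the powers of
the maximal ideal of `O⟦X⟧` by conditions on the coefficients. -/
theorem coeff_mem_of_mem_maximalIdeal_pow {O : Type*} [CommRing O] [IsLocalRing O] (n : ℕ) :
    ∀ (f : O⟦X⟧), f ∈ maximalIdeal O⟦X⟧ ^ n → ∀ i, coeff i f ∈ maximalIdeal O ^ (n - i) := by
  induction n with
  | zero => intro f _ i; simp
  | succ n ih =>
    intro f hf i
    rw [pow_succ'] at hf
    refine Submodule.mul_induction_on hf (fun a ha b hb => ?_) (fun x y hx hy => ?_)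
    · rw [coeff_mul]
      refine Ideal.sum_mem _ fun jl hjl => ?_
      rw [Finset.HasAntidiagonal.mem_antidiagonal] at hjl
      have hb' := ih b hb jl.2
      by_cases hj : jl.1 = 0
      · have ha0 : coeff jl.1 a ∈ maximalIdeal O := by
          rw [hj, coeff_zero_eq_constantCoeff_apply]
          rw [mem_maximalIdeal, mem_nonunits_iff, isUnit_iff_constantCoeff] at ha
          exact ha
        have := Ideal.mul_mem_mul ha0 hb'
        rw [← pow_succ'] at this
        exact Ideal.pow_le_pow_right (by omega) this
      · exact Ideal.mul_mem_left _ _ (Ideal.pow_le_pow_right (by omega) hb')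
    · rw [map_add]
      exact Ideal.add_mem _ hx hy

theorem X_mem_maximalIdeal_powerSeries {O : Type*} [CommRing O] [IsLocalRing O] :
    (X : O⟦X⟧) ∈ maximalIdeal O⟦X⟧ := by
  rw [mem_maximalIdeal, mem_nonunits_iff, isUnit_iff_constantCoeff]
  simp

theorem mem_maximalIdeal_pow_of_coeff_mem {O : Type*} [CommRing O] [IsLocalRing O] (n : ℕ) :
    ∀ f : O⟦X⟧, (∀ i, coeff i f ∈ maximalIdeal O ^ (n - i)) → f ∈ maximalIdeal O⟦X⟧ ^ n := by
  have hC : (maximalIdeal O).map (C : O →+* O⟦X⟧) ≤ maximalIdeal O⟦X⟧ := by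
    rw [Ideal.map_le_iff_le_comap]
    intro x hx
    rw [Ideal.mem_comap, mem_maximalIdeal, mem_nonunits_iff, isUnit_iff_constantCoeff,
      constantCoeff_C]
    exact hx
  induction n with
  | zero => intro f _; simp
  | succ n ih =>
    intro f hf
    rw [eq_X_mul_shift_add_const f]
    refine Ideal.add_mem _ ?_ ?_
    · rw [pow_succ']
      refine Ideal.mul_mem_mul X_mem_maximalIdeal_powerSeries (ih _ fun i => ?_)
      have h := hf (i + 1)
      rwa [Nat.add_sub_add_right, ← coeff_mk i fun k => coeff (k + 1) f] at h
    · refine Ideal.pow_right_mono hC (n + 1) ?_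
      rw [← Ideal.map_pow]
      refine Ideal.mem_map_of_mem C ?_
      simpa using hf 0

/-- `O⟦X⟧` is complete for its maximal ideal. -/
theorem exists_limit_powerSeries {O : Type*} [CommRing O] [IsLocalRing O]
    [IsAdicComplete (maximalIdeal O) O] (f : ℕ → O⟦X⟧)
    (hf : ∀ m n, m ≤ n → f n - f m ∈ maximalIdeal O⟦X⟧ ^ m) :
    ∃ g : O⟦X⟧, ∀ n, g - f n ∈ maximalIdeal O⟦X⟧ ^ n := by
  have hlim : ∀ i, ∃ L : O, ∀ n,
      coeff i (f (n + i)) ≡ L [SMOD maximalIdeal O ^ n • (⊤ : Ideal O)] := by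
    intro i
    refine IsPrecomplete.prec inferInstance fun {m n} hmn => ?_
    have h := coeff_mem_of_mem_maximalIdeal_pow _ _ (hf (m + i) (n + i) (by omega)) i
    rw [SModEq.comm, SModEq.sub_mem, smul_eq_mul, Ideal.mul_top, ← map_sub]
    rwa [Nat.add_sub_cancel] at h
  choose L hL using hlim
  refine ⟨PowerSeries.mk L, fun n => mem_maximalIdeal_pow_of_coeff_mem n _ fun i => ?_⟩
  by_cases hi : i ≤ n
  · have h := hL i (n - i)
    rw [SModEq.comm, SModEq.sub_mem, smul_eq_mul, Ideal.mul_top, Nat.sub_add_cancel hi] at h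
    rwa [map_sub, coeff_mk]
  · rw [Nat.sub_eq_zero_of_le (by omega), pow_zero, Ideal.one_eq_top]
    trivial

/-- Ideals of a noetherian local ring are closed for the maximal ideal topology. -/
theorem mem_of_forall_mem_sup_maximalIdeal_pow {R : Type*} [CommRing R] [IsNoetherianRing R]
    [IsLocalRing R] (I : Ideal R) (x : R) (hx : ∀ n, ∃ k ≥ n, x ∈ I ⊔ maximalIdeal R ^ k) :
    x ∈ I := by
  rw [← Ideal.Quotient.eq_zero_iff_mem]
  have hbot := Ideal.iInf_pow_smul_eq_bot_of_isLocalRing (M := R ⧸ I) (maximalIdeal R)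
    (Ideal.IsPrime.ne_top inferInstance)
  rw [← Submodule.mem_bot R, ← hbot, Submodule.mem_iInf]
  intro n
  obtain ⟨k, hk, hxk⟩ := hx n
  obtain ⟨y, hy, z, hz, rfl⟩ := Submodule.mem_sup.1 hxk
  rw [map_add, Ideal.Quotient.eq_zero_iff_mem.2 hy, zero_add]
  have h : z • (1 : R ⧸ I) ∈ maximalIdeal R ^ n • (⊤ : Submodule R (R ⧸ I)) :=
    Submodule.smul_mem_smul (Ideal.pow_le_pow_right hk hz) trivial
  rwa [Algebra.smul_def, mul_one] at h

theorem layerPoly_mem_maximalIdeal_pow {O : Type*} [CommRing O] [IsLocalRing O] (p : ℕ)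
    [CharP (ResidueField O) p] (n : ℕ) :
    (layerPoly O (p ^ n) : O⟦X⟧) ∈ maximalIdeal O⟦X⟧ ^ (n + 1) := by
  induction n with
  | zero =>
    rw [pow_zero, zero_add, pow_one, layerPoly, pow_one, add_sub_cancel_right, Polynomial.coe_X]
    exact X_mem_maximalIdeal_powerSeries
  | succ n ih =>
    have h : layerPoly O (p ^ (n + 1)) =
        (∑ i ∈ Finset.range p, ((Polynomial.X + 1 : Polynomial O) ^ p ^ n) ^ i) *
          layerPoly O (p ^ n) := by
      rw [layerPoly, layerPoly, geom_sum_mul, ← pow_mul, ← pow_succ]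
    rw [h, Polynomial.coe_mul, pow_succ']
    refine Ideal.mul_mem_mul ?_ ih
    -- the constant coefficient of the cofactor is `p`, which lies in the maximal ideal
    rw [mem_maximalIdeal, mem_nonunits_iff, isUnit_iff_constantCoeff,
      ← coeff_zero_eq_constantCoeff_apply, Polynomial.coeff_coe, Polynomial.coeff_zero_eq_eval_zero,
      ← mem_nonunits_iff, ← mem_maximalIdeal, ← residue_eq_zero_iff]
    simp [Polynomial.eval_finsetSum]

end Completeness

/-! ### The Iwasawa algebra as a power series ring -/

section IwasawaEquiv

open PowerSeries IsLocalRing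

theorem mk_pow_eq_one {p : ℕ} {Γ : Type*} [CommGroup Γ] (γ : Γ) (n : ℕ) :
    (γ : Γ ⧸ powSubgroup p Γ n) ^ p ^ n = 1 := by
  rw [← QuotientGroup.mk_pow, QuotientGroup.eq_one_iff]
  exact ⟨γ, rfl⟩

theorem mapDomainAlgHom_evalGroupRing {p : ℕ} {O : Type*} [CommRing O] {Γ : Type*}
    [CommGroup Γ] (γ : Γ) {m n : ℕ} (h : m ≤ n) (r : Polynomial O) :
    MonoidAlgebra.mapDomainAlgHom O O (layerMap p Γ h)
      (evalGroupRing O (γ : Γ ⧸ powSubgroup p Γ n) r) =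
      evalGroupRing O (γ : Γ ⧸ powSubgroup p Γ m) r := by
  rw [evalGroupRing, evalGroupRing, ← Polynomial.aeval_algHom_apply, map_sub, map_one,
    MonoidAlgebra.of_apply, MonoidAlgebra.mapDomainAlgHom_apply, MonoidAlgebra.mapDomain_single]
  rfl

variable {p : ℕ} [Fact p.Prime] {O : Type*} [CommRing O] [IsLocalRing O]
  [IsAdicComplete (maximalIdeal O) O] [CharP (ResidueField O) p]
  {Γ : Type*} [CommGroup Γ]

variable (p O) in
/-- The map `O⟦X⟧ → O[Γ / Γ ^ (p ^ n)]` sending `X` to `γ - 1`. -/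
noncomputable def layerHom (γ : Γ) (n : ℕ) :
    O⟦X⟧ →ₐ[O] MonoidAlgebra O (Γ ⧸ powSubgroup p Γ n) :=
  powerSeriesEval (γ : Γ ⧸ powSubgroup p Γ n) (isDistinguishedAt_layerPoly p n)
    (evalGroupRing_layerPoly (mk_pow_eq_one γ n))

theorem layerHom_compatible (γ : Γ) {m n : ℕ} (h : m ≤ n) (f : O⟦X⟧) :
    MonoidAlgebra.mapDomainAlgHom O O (layerMap p Γ h) (layerHom p O γ n f) =
      layerHom p O γ m f := by
  obtain ⟨r, hr⟩ := exists_polynomial_sub_mem_span (isDistinguishedAt_layerPoly (O := O) p n) f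
  obtain ⟨b, hb⟩ := Ideal.mem_span_singleton'.1 hr
  obtain rfl : f = b * (layerPoly O (p ^ n) : O⟦X⟧) + (r : O⟦X⟧) := by rw [hb, sub_add_cancel]
  have hn : layerHom p O γ n (layerPoly O (p ^ n) : O⟦X⟧) = 0 := by
    rw [layerHom, powerSeriesEval_coe, evalGroupRing_layerPoly (mk_pow_eq_one γ n)]
  have hm : layerHom p O γ m (layerPoly O (p ^ n) : O⟦X⟧) = 0 := by
    rw [layerHom, powerSeriesEval_coe]
    refine evalGroupRing_layerPoly ?_
    obtain ⟨k, hk⟩ := pow_dvd_pow p h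
    rw [hk, pow_mul, mk_pow_eq_one, one_pow]
  rw [map_add, map_add, map_add, map_mul, map_mul, map_mul, hn, hm, map_zero, mul_zero, mul_zero,
    zero_add, zero_add, layerHom, layerHom, powerSeriesEval_coe, powerSeriesEval_coe,
    mapDomainAlgHom_evalGroupRing]

variable (p O) in
/-- The map `O⟦X⟧ → O[[Γ]]` sending `X` to `γ - 1`. -/
noncomputable def powerSeriesToIwasawa (γ : Γ) : O⟦X⟧ →ₐ[O] IwasawaAlgebra p O Γ :=
  AlgHom.codRestrict (AlgHom.pi fun n => layerHom p O γ n)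
    (iwasawaSubalgebra p O Γ) fun f _ _ h => layerHom_compatible γ h f

theorem powerSeriesToIwasawa_coe (γ : Γ) (F : Polynomial O) :
    powerSeriesToIwasawa p O γ (F : O⟦X⟧) = polyAt p γ F := by
  have h : (powerSeriesToIwasawa p O γ).comp (Polynomial.coeToPowerSeries.algHom O) =
      Polynomial.aeval (IwasawaAlgebra.of p O γ - 1) := by
    refine Polynomial.algHom_ext ?_
    rw [Polynomial.aeval_X]
    refine Subtype.ext (funext fun n => ?_)
    have h1 := powerSeriesEval_coe (γ : Γ ⧸ powSubgroup p Γ n) (isDistinguishedAt_layerPoly p n)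
      (evalGroupRing_layerPoly (mk_pow_eq_one γ n)) (Polynomial.X : Polynomial O)
    rw [evalGroupRing, Polynomial.aeval_X] at h1
    refine Eq.trans ?_ h1
    change layerHom p O γ n (Polynomial.coeToPowerSeries.algHom O Polynomial.X) = _
    rw [Polynomial.coeToPowerSeries.algHom_apply, Algebra.algebraMap_self, PowerSeries.map_id]
    rfl
  have h2 := AlgHom.congr_fun h F
  rw [AlgHom.comp_apply, Polynomial.coeToPowerSeries.algHom_apply, Algebra.algebraMap_self,
    PowerSeries.map_id] at h2
  exact h2

theorem powerSeriesToIwasawa_bijective [IsNoetherianRing O] [TopologicalSpace Γ]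
    [IsTopologicalGroup Γ]
    (e : Γ ≃ₜ* Multiplicative ℤ_[p]) {γ : Γ} (hγ : Dense (Subgroup.zpowers γ : Set Γ)) :
    Function.Bijective (powerSeriesToIwasawa p O γ) := by
  have hker : ∀ n f, layerHom p O γ n f = 0 ↔
      f ∈ Ideal.span {(layerPoly O (p ^ n) : O⟦X⟧)} := fun n f =>
    ker_powerSeriesEval _ _ (by
      rw [orderOf_mk_powSubgroup e hγ]
      exact (monic_layerPoly (pow_ne_zero n (Fact.out : p.Prime).ne_zero)).2) f
  have hle : ∀ n, Ideal.span {(layerPoly O (p ^ n) : O⟦X⟧)} ≤ maximalIdeal O⟦X⟧ ^ (n + 1) :=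
    fun n => (Ideal.span_singleton_le_iff_mem _).2 (layerPoly_mem_maximalIdeal_pow p n)
  have hcoord : ∀ f n, (powerSeriesToIwasawa p O γ f).1 n = layerHom p O γ n f := fun _ _ => rfl
  constructor
  · rw [injective_iff_map_eq_zero]
    intro f hf
    rw [← Ideal.mem_bot]
    refine mem_of_forall_mem_sup_maximalIdeal_pow ⊥ f fun n => ⟨n + 1, by omega, ?_⟩
    rw [bot_sup_eq]
    refine hle n ((hker n f).1 ?_)
    rw [← hcoord, hf]
    rfl
  · rintro ⟨x, hx⟩
    have hsurj : ∀ n, ∃ f, layerHom p O γ n f = x n := fun n =>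
      powerSeriesEval_surjective _ _ (fun y => by
        obtain ⟨k, rfl⟩ := exists_zpow_eq_mk e hγ n y
        have hfin : IsOfFinOrder (γ : Γ ⧸ powSubgroup p Γ n) :=
          orderOf_pos_iff.1 (by
            rw [orderOf_mk_powSubgroup e hγ]
            exact pow_pos (Fact.out : p.Prime).pos n)
        exact hfin.mem_powers_iff_mem_zpowers.2 ⟨k, rfl⟩) (x n)
    choose f hf using hsurj
    have hdiff : ∀ m n, m ≤ n → f n - f m ∈ Ideal.span {(layerPoly O (p ^ m) : O⟦X⟧)} := by
      intro m n hmn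
      rw [← hker, map_sub, ← layerHom_compatible γ hmn, hf, hf, hx m n hmn, sub_self]
    obtain ⟨g, hg⟩ := exists_limit_powerSeries f fun m n hmn =>
      Ideal.pow_le_pow_right (Nat.le_succ m) (hle m (hdiff m n hmn))
    refine ⟨g, Subtype.ext (funext fun n => ?_)⟩
    rw [hcoord]
    change _ = x n
    rw [← hf n, ← sub_eq_zero, ← map_sub, hker]
    refine mem_of_forall_mem_sup_maximalIdeal_pow _ _ fun k => ⟨k + n, by omega, ?_⟩
    rw [← sub_add_sub_cancel g (f (k + n)) (f n)]
    exact Ideal.add_mem _ (Ideal.mem_sup_right (hg _))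
      (Ideal.mem_sup_left (hdiff n (k + n) (by omega)))

/-- A topological generator `γ` identifies `O⟦X⟧` with `O[[Γ]]`, the variable `X` corresponding to
`γ - 1`. -/
noncomputable def powerSeriesEquivIwasawa [IsNoetherianRing O] [TopologicalSpace Γ]
    [IsTopologicalGroup Γ]
    (e : Γ ≃ₜ* Multiplicative ℤ_[p]) {γ : Γ} (hγ : Dense (Subgroup.zpowers γ : Set Γ)) :
    O⟦X⟧ ≃ₐ[O] IwasawaAlgebra p O Γ :=
  AlgEquiv.ofBijective (powerSeriesToIwasawa p O γ) (powerSeriesToIwasawa_bijective e hγ)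

end IwasawaEquiv

/-! ### Ranks of pseudo-isomorphic modules -/

theorem IsPseudoIso.linearEquiv_comp {R M N P : Type*} [CommRing R] [AddCommGroup M] [Module R M]
    [AddCommGroup N] [Module R N] [AddCommGroup P] [Module R P] {f : M →ₗ[R] N}
    (hf : IsPseudoIso f) (e : N ≃ₗ[R] P) : IsPseudoIso (e.toLinearMap ∘ₗ f) := by
  obtain ⟨h1, h2⟩ := hf
  refine ⟨?_, ?_⟩
  · rw [LinearEquiv.ker_comp]
    exact h1
  · exact Finite.of_equiv _ (Submodule.Quotient.equiv (LinearMap.range f)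
      (LinearMap.range (e.toLinearMap ∘ₗ f)) e (by rw [LinearMap.range_comp])).toEquiv

/-- The elements of a finite module over a local ring are annihilated by a power of any given
element of the maximal ideal. -/
theorem exists_pow_smul_eq_zero_of_finite {A N : Type*} [CommRing A] [IsLocalRing A]
    [AddCommGroup N] [Module A N] [Finite N] {t : A} (ht : t ∈ IsLocalRing.maximalIdeal A) (x : N) :
    ∃ n : ℕ, t ^ n • x = 0 := by
  obtain ⟨i, j, hij, h⟩ := Finite.exists_ne_map_eq_of_infinite fun n : ℕ => t ^ n • x
  wlog hlt : i < j generalizing i j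
  · exact this j i hij.symm h.symm (by omega)
  refine ⟨i, ?_⟩
  -- `t ^ i • x = t ^ j • x` and `1 - t ^ (j - i)` is a unit
  have hunit : IsUnit (1 - t ^ (j - i)) := by
    have hmem : t ^ (j - i) ∈ IsLocalRing.maximalIdeal A :=
      Ideal.pow_mem_of_mem _ ht _ (by omega)
    exact IsLocalRing.isUnit_one_sub_self_of_mem_nonunits _ hmem
  refine (hunit.smul_eq_zero).1 ?_
  rw [sub_smul, one_smul, smul_smul, ← pow_add, Nat.sub_add_cancel hlt.le, sub_eq_zero]
  exact h

/-- A linear map over a noetherian domain with torsion kernel and cokernel preserves the rank. -/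
theorem finrank_eq_of_torsion_ker_coker {B P Q : Type*} [CommRing B] [IsDomain B]
    [IsNoetherianRing B] [AddCommGroup P] [Module B P] [Module.Finite B P] [AddCommGroup Q]
    [Module B Q] [Module.Finite B Q] (g : P →ₗ[B] Q)
    (hker : ∀ x, g x = 0 → ∃ b : B, b ≠ 0 ∧ b • x = 0)
    (hcoker : ∀ y, ∃ b : B, b ≠ 0 ∧ ∃ x, g x = b • y) :
    Module.finrank B P = Module.finrank B Q := by
  have h1 : Module.finrank B (LinearMap.ker g) = 0 := by
    rw [Module.finrank_eq_zero_iff_isTorsion]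
    rintro ⟨x, hx⟩
    obtain ⟨b, hb, hbx⟩ := hker x hx
    exact ⟨⟨b, mem_nonZeroDivisors_of_ne_zero hb⟩, Subtype.ext hbx⟩
  have h2 : Module.finrank B (Q ⧸ LinearMap.range g) = 0 := by
    rw [Module.finrank_eq_zero_iff_isTorsion]
    intro y
    obtain ⟨y, rfl⟩ := Submodule.Quotient.mk_surjective _ y
    obtain ⟨b, hb, x, hx⟩ := hcoker y
    exact ⟨⟨b, mem_nonZeroDivisors_of_ne_zero hb⟩, (Submodule.Quotient.mk_eq_zero _).2 ⟨x, hx⟩⟩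
  rw [← Submodule.finrank_quotient_add_finrank (LinearMap.ker g), h1,
    g.quotKerEquivRange.finrank_eq, ← Submodule.finrank_quotient_add_finrank (LinearMap.range g),
    h2, add_zero, zero_add]

section ElementaryRank

variable {A M : Type*} [CommRing A] [IsNoetherianRing A] [IsLocalRing A]
  [AddCommGroup M] [Module A M] [Module.Finite A M] {ϖ t : A} {r s k : ℕ} {a : Fin s → ℕ}
  {F : Fin k → A}
  {f : M →ₗ[A] (Fin r → A) × (∀ i, A ⧸ Ideal.span {ϖ ^ a i}) × (∀ j, A ⧸ Ideal.span {F j})}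

/-- A module pseudo-isomorphic to an elementary module with free part `A ^ r` has rank `r`. -/
theorem finrank_eq_of_isPseudoIso [IsDomain A] (hϖ : Prime ϖ) (ht : t ∈ IsLocalRing.maximalIdeal A)
    (ht0 : t ≠ 0) (hF : ∀ j, F j ≠ 0) (hf : IsPseudoIso f) : Module.finrank A M = r := by
  obtain ⟨h1, h2⟩ := hf
  rw [finrank_eq_of_torsion_ker_coker (LinearMap.fst A _ _ ∘ₗ f), Module.finrank_fin_fun]
  · intro x hx
    set c := (∏ i, ϖ ^ a i) * ∏ j, F j with hc
    have hc0 : c ≠ 0 := mul_ne_zero (Finset.prod_ne_zero_iff.2 fun i _ => pow_ne_zero _ hϖ.ne_zero)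
      (Finset.prod_ne_zero_iff.2 fun j _ => hF j)
    have hcx : f (c • x) = 0 := by
      rw [map_smul]
      refine Prod.ext ?_ (Prod.ext ?_ ?_)
      · rw [Prod.smul_fst, show (f x).1 = 0 from hx, smul_zero, Prod.fst_zero]
      · change c • (f x).2.1 = 0
        rw [hc, mul_comm, mul_smul, prod_smul_eq_zero_of_quotient, smul_zero]
      · change c • (f x).2.2 = 0
        rw [hc, mul_smul, prod_smul_eq_zero_of_quotient, smul_zero]
    obtain ⟨n, hn⟩ := exists_pow_smul_eq_zero_of_finite ht (⟨c • x, hcx⟩ : LinearMap.ker f)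
    refine ⟨t ^ n * c, mul_ne_zero (pow_ne_zero _ ht0) hc0, ?_⟩
    rw [mul_smul]
    exact congrArg Subtype.val hn
  · intro y
    obtain ⟨n, hn⟩ := exists_pow_smul_eq_zero_of_finite ht
      (Submodule.Quotient.mk (y, 0) : _ ⧸ LinearMap.range f)
    obtain ⟨x, hx⟩ := (Submodule.Quotient.mk_eq_zero (LinearMap.range f)).1 hn
    refine ⟨t ^ n, pow_ne_zero _ ht0, x, ?_⟩
    rw [LinearMap.comp_apply, hx]
    rfl

/-- If `M` is pseudo-isomorphic to an elementary module with free part `A ^ r` and `s` factors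
`A / (ϖ ^ a)`, `a ≥ 1`, then `M / ϖ M` has rank `r + s` over `A / (ϖ)`. -/
theorem finrank_quotient_eq_of_isPseudoIso (hϖ : Prime ϖ) (ht : t ∈ IsLocalRing.maximalIdeal A)
    (htϖ : ¬ ϖ ∣ t) (ha : ∀ i, 1 ≤ a i) (hF : ∀ j, ¬ ϖ ∣ F j) (hf : IsPseudoIso f) :
    Module.finrank (A ⧸ Ideal.span {ϖ}) (M ⧸ (Ideal.span {ϖ} • (⊤ : Submodule A M))) = r + s := by
  obtain ⟨h1, h2⟩ := hf
  have hprime : (Ideal.span {ϖ}).IsPrime := (Ideal.span_singleton_prime hϖ.ne_zero).2 hϖ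
  have hdom : IsDomain (A ⧸ Ideal.span {ϖ}) := Ideal.Quotient.isDomain _
  set B := A ⧸ Ideal.span {ϖ}
  -- the reduction of the elementary module, forgetting the factors `A / (F j)`
  let ψ : ((Fin r → A) × (∀ i, A ⧸ Ideal.span {ϖ ^ a i}) × (∀ j, A ⧸ Ideal.span {F j})) →ₗ[A]
      (Fin r → B) × (Fin s → B) :=
    LinearMap.prodMap (LinearMap.pi fun i => (Ideal.span {ϖ}).mkQ ∘ₗ LinearMap.proj i)
      ((LinearMap.pi fun i => Submodule.factor (Ideal.span_singleton_le_span_singleton.2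
        (dvd_pow_self ϖ (Nat.one_le_iff_ne_zero.1 (ha i)))) ∘ₗ LinearMap.proj i) ∘ₗ
          LinearMap.fst A _ _)
  let g₀ : (M ⧸ (Ideal.span {ϖ} • (⊤ : Submodule A M))) →ₗ[A] (Fin r → B) × (Fin s → B) :=
    Submodule.liftQ _ (ψ ∘ₗ f) (by
      rw [Submodule.smul_le]
      intro c hc m _
      have hcB : ∀ b : B, c • b = 0 := fun b => by
        obtain ⟨b, rfl⟩ := Ideal.Quotient.mk_surjective b
        exact Ideal.Quotient.eq_zero_iff_mem.2 (Ideal.mul_mem_right _ _ hc)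
      rw [LinearMap.mem_ker, map_smul]
      exact Prod.ext (funext fun i => hcB _) (funext fun i => hcB _))
  have hg₀ : ∀ m, g₀ (Submodule.Quotient.mk m) = ψ (f m) := fun m => rfl
  let g := g₀.extendScalarsOfSurjective (S := B) Ideal.Quotient.mk_surjective
  have : Module.Finite B (M ⧸ (Ideal.span {ϖ} • (⊤ : Submodule A M))) :=
    Module.Finite.of_restrictScalars_finite A _ _
  have hmk0 : ∀ c : A, ¬ ϖ ∣ c → (Ideal.Quotient.mk (Ideal.span {ϖ}) c) ≠ 0 := fun c hc h =>
    hc (Ideal.mem_span_singleton.1 (Ideal.Quotient.eq_zero_iff_mem.1 h))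
  have htn : ∀ n, ¬ ϖ ∣ t ^ n := fun n h => htϖ (hϖ.dvd_of_dvd_pow h)
  have hcok : ∀ e, ∃ n x, f x = t ^ n • e := fun e => by
    obtain ⟨n, hn⟩ := exists_pow_smul_eq_zero_of_finite ht
      (Submodule.Quotient.mk e : _ ⧸ LinearMap.range f)
    obtain ⟨x, hx⟩ := (Submodule.Quotient.mk_eq_zero (LinearMap.range f)).1 hn
    exact ⟨n, x, hx⟩
  rw [finrank_eq_of_torsion_ker_coker g]
  · rw [Module.finrank_prod, Module.finrank_fin_fun, Module.finrank_fin_fun]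
  · intro x hx
    obtain ⟨m, rfl⟩ := Submodule.Quotient.mk_surjective _ x
    replace hx : ψ (f m) = 0 := hx
    have hc0 : ¬ ϖ ∣ ∏ j, F j := fun h => by
      obtain ⟨j, -, hj⟩ := (hϖ.dvd_finsetProd_iff F).1 h
      exact hF j hj
    -- after multiplication by the product of the `F j`, the image of `m` is divisible by `ϖ`
    have hdiv : ∃ e, (∏ j, F j) • f m = ϖ • e := by
      have hx1 : ∀ i, ∃ z, (f m).1 i = ϖ * z := fun i =>
        Ideal.mem_span_singleton.1 ((Submodule.Quotient.mk_eq_zero _).1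
          (congrFun (congrArg Prod.fst hx) i))
      have hx2 : ∀ i, ∃ z, (f m).2.1 i = ϖ • z := fun i => by
        obtain ⟨w, hw⟩ := Submodule.Quotient.mk_surjective _ ((f m).2.1 i)
        have h0 : Submodule.factor (Ideal.span_singleton_le_span_singleton.2
            (dvd_pow_self ϖ (Nat.one_le_iff_ne_zero.1 (ha i)))) ((f m).2.1 i) = 0 :=
          congrFun (congrArg Prod.snd hx) i
        rw [← hw] at h0 ⊢
        obtain ⟨z, rfl⟩ := Ideal.mem_span_singleton.1 ((Submodule.Quotient.mk_eq_zero _).1 h0)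
        exact ⟨Submodule.Quotient.mk z, rfl⟩
      choose z₁ hz₁ using hx1
      choose z₂ hz₂ using hx2
      refine ⟨(∏ j, F j) • (z₁, z₂, 0), ?_⟩
      rw [smul_comm]
      refine Prod.ext ?_ (Prod.ext ?_ ?_)
      · exact congrArg ((∏ j, F j) • ·) (funext hz₁)
      · exact congrArg ((∏ j, F j) • ·) (funext hz₂)
      · change (∏ j, F j) • (f m).2.2 = (∏ j, F j) • ϖ • 0
        rw [prod_smul_eq_zero_of_quotient, smul_zero, smul_zero]
    obtain ⟨e, he⟩ := hdiv
    obtain ⟨n, y, hy⟩ := hcok e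
    have hker : f ((t ^ n * ∏ j, F j) • m - ϖ • y) = 0 := by
      rw [map_sub, map_smul, map_smul, mul_smul, he, hy, smul_comm, sub_self]
    obtain ⟨l, hl⟩ := exists_pow_smul_eq_zero_of_finite ht (⟨_, hker⟩ : LinearMap.ker f)
    replace hl : t ^ l • ((t ^ n * ∏ j, F j) • m - ϖ • y) = 0 := congrArg Subtype.val hl
    refine ⟨Ideal.Quotient.mk _ (t ^ l * (t ^ n * ∏ j, F j)), hmk0 _ fun h => ?_, ?_⟩
    · rcases hϖ.dvd_or_dvd h with h | h
      · exact htn l h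
      · rcases hϖ.dvd_or_dvd h with h | h
        · exact htn n h
        · exact hc0 h
    · change Submodule.Quotient.mk ((t ^ l * (t ^ n * ∏ j, F j)) • m) = _
      rw [Submodule.Quotient.mk_eq_zero]
      rw [smul_sub, sub_eq_zero, smul_smul, smul_comm] at hl
      rw [hl]
      exact Submodule.smul_mem_smul (Ideal.mem_span_singleton_self ϖ) trivial
  · rintro ⟨y₁, y₂⟩
    choose z₁ hz₁ using fun i => Ideal.Quotient.mk_surjective (y₁ i)
    choose z₂ hz₂ using fun i => Ideal.Quotient.mk_surjective (y₂ i)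
    obtain ⟨n, x, hx⟩ := hcok (z₁, fun i => Ideal.Quotient.mk _ (z₂ i), 0)
    refine ⟨Ideal.Quotient.mk _ (t ^ n), hmk0 _ (htn n), Submodule.Quotient.mk x, ?_⟩
    change ψ (f x) = t ^ n • (y₁, y₂)
    rw [hx, map_smul]
    exact congrArg (t ^ n • ·) (Prod.ext (funext hz₁) (funext hz₂))

end ElementaryRank

/-! ### The `μ`-invariant of a module over the Iwasawa algebra -/

/-- Sorting the cyclic factors of the target of a pseudo-isomorphism into powers of `ϖ` and
quotients by values of a function `v`. -/
theorem exists_isPseudoIso_sorted {A M Φ : Type*} [CommRing A] [AddCommGroup M] [Module A M]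
    {r : ℕ} {ι : Type*} [Fintype ι] {I : ι → Ideal A}
    {f : M →ₗ[A] (Fin r → A) × (∀ i, A ⧸ I i)} (hf : IsPseudoIso f) (ϖ : A) (v : Φ → A)
    (D : Φ → Prop)
    (hI : ∀ i, (∃ n, 1 ≤ n ∧ I i = Ideal.span {ϖ ^ n}) ∨ ∃ F, D F ∧ I i = Ideal.span {v F}) :
    ∃ (s t : ℕ) (a : Fin s → ℕ) (F : Fin t → Φ)
      (f' : M →ₗ[A] (Fin r → A) × (∀ i, A ⧸ Ideal.span {ϖ ^ a i}) ×
        (∀ j, A ⧸ Ideal.span {v (F j)})),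
      (∀ i, 1 ≤ a i) ∧ (∀ j, D (F j)) ∧ IsPseudoIso f' := by
  classical
  let P : ι → Prop := fun i => ∃ n, 1 ≤ n ∧ I i = Ideal.span {ϖ ^ n}
  let σ : Fin (Fintype.card {i // P i}) ⊕ Fin (Fintype.card {i // ¬ P i}) ≃ ι :=
    (Equiv.sumCongr (Fintype.equivFin _).symm (Fintype.equivFin _).symm).trans (Equiv.sumCompl P)
  have h1 : ∀ i, ∃ n, 1 ≤ n ∧ I (σ (Sum.inl i)) = Ideal.span {ϖ ^ n} := fun i =>
    ((Fintype.equivFin {i // P i}).symm i).2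
  have h2 : ∀ j, ∃ F, D F ∧ I (σ (Sum.inr j)) = Ideal.span {v F} := fun j =>
    (hI _).resolve_left ((Fintype.equivFin {i // ¬ P i}).symm j).2
  choose a ha haI using h1
  choose F hF hFI using h2
  let e : (∀ i, A ⧸ I i) ≃ₗ[A]
      (∀ i, A ⧸ Ideal.span {ϖ ^ a i}) × (∀ j, A ⧸ Ideal.span {v (F j)}) :=
    (LinearEquiv.piCongrLeft A (fun i => A ⧸ I i) σ).symm ≪≫ₗ
      LinearEquiv.sumPiEquivProdPi A _ _ (fun k => A ⧸ I (σ k)) ≪≫ₗ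
      LinearEquiv.prodCongr
        (LinearEquiv.piCongrRight fun i => Submodule.quotEquivOfEq _ _ (haI i))
        (LinearEquiv.piCongrRight fun j => Submodule.quotEquivOfEq _ _ (hFI j))
  exact ⟨_, _, a, F, _, ha, hF,
    hf.linearEquiv_comp (LinearEquiv.prodCongr (LinearEquiv.refl A _) e)⟩

section MuInvariant

open PowerSeries IsLocalRing

variable {p : ℕ} [Fact p.Prime] {O : Type*} [CommRing O] [IsDomain O] [IsDiscreteValuationRing O]
  [IsAdicComplete (maximalIdeal O) O] [CharP (ResidueField O) p]
  {ϖ : O} {Γ : Type*} [CommGroup Γ] [TopologicalSpace Γ] [IsTopologicalGroup Γ]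

theorem powerSeriesEquivIwasawa_C (e : Γ ≃ₜ* Multiplicative ℤ_[p]) {γ : Γ}
    (hγ : Dense (Subgroup.zpowers γ : Set Γ)) (c : O) :
    powerSeriesEquivIwasawa e hγ (C c) = algebraMap O (IwasawaAlgebra p O Γ) c :=
  (powerSeriesEquivIwasawa e hγ).commutes c

theorem powerSeriesEquivIwasawa_coe (e : Γ ≃ₜ* Multiplicative ℤ_[p]) {γ : Γ}
    (hγ : Dense (Subgroup.zpowers γ : Set Γ)) (F : Polynomial O) :
    powerSeriesEquivIwasawa e hγ (F : O⟦X⟧) = polyAt p γ F :=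
  powerSeriesToIwasawa_coe γ F

theorem IwasawaAlgebra.isDomain (e : Γ ≃ₜ* Multiplicative ℤ_[p]) :
    IsDomain (IwasawaAlgebra p O Γ) := by
  obtain ⟨γ, hγ⟩ := exists_dense_zpowers e
  exact (powerSeriesEquivIwasawa e hγ).symm.toMulEquiv.isDomain O⟦X⟧

theorem IwasawaAlgebra.isNoetherianRing (e : Γ ≃ₜ* Multiplicative ℤ_[p]) :
    IsNoetherianRing (IwasawaAlgebra p O Γ) := by
  obtain ⟨γ, hγ⟩ := exists_dense_zpowers e
  exact isNoetherianRing_of_ringEquiv O⟦X⟧ (powerSeriesEquivIwasawa e hγ).toRingEquiv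

theorem IwasawaAlgebra.isLocalRing (e : Γ ≃ₜ* Multiplicative ℤ_[p]) :
    IsLocalRing (IwasawaAlgebra p O Γ) := by
  obtain ⟨γ, hγ⟩ := exists_dense_zpowers e
  exact (powerSeriesEquivIwasawa (O := O) e hγ).toRingEquiv.isLocalRing

theorem IwasawaAlgebra.prime_uniformizer (hϖ : Irreducible ϖ) (e : Γ ≃ₜ* Multiplicative ℤ_[p]) :
    Prime (algebraMap O (IwasawaAlgebra p O Γ) ϖ) := by
  obtain ⟨γ, hγ⟩ := exists_dense_zpowers e
  rw [← powerSeriesEquivIwasawa_C e hγ, MulEquiv.prime_iff]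
  exact prime_C_uniformizer hϖ

/-- A monic polynomial in `γ - 1`, for instance a distinguished one, is not divisible by `ϖ` in the
Iwasawa algebra. -/
theorem not_dvd_polyAt (hϖ : Irreducible ϖ) (e : Γ ≃ₜ* Multiplicative ℤ_[p]) {γ : Γ}
    (hγ : Dense (Subgroup.zpowers γ : Set Γ)) {F : Polynomial O}
    (hF : F.Monic) : ¬ algebraMap O (IwasawaAlgebra p O Γ) ϖ ∣ polyAt p γ F := by
  rw [← powerSeriesEquivIwasawa_C e hγ, ← powerSeriesEquivIwasawa_coe e hγ, map_dvd_iff]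
  rintro ⟨g, hg⟩
  have h := congrArg (coeff F.natDegree) hg
  rw [Polynomial.coeff_coe, hF.coeff_natDegree, coeff_C_mul] at h
  exact hϖ.not_isUnit (IsUnit.of_mul_eq_one _ h.symm)

/-- **Structure theorem** for finitely generated modules over the Iwasawa algebra. -/
theorem exists_hasMuInvariant [Finite (ResidueField O)] (hϖ : Irreducible ϖ)
    (e : Γ ≃ₜ* Multiplicative ℤ_[p]) (M : Type*) [AddCommGroup M]
    [Module (IwasawaAlgebra p O Γ) M] [Module.Finite (IwasawaAlgebra p O Γ) M] :
    ∃ m, HasMuInvariant p Γ ϖ M m := by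
  obtain ⟨γ, hγ⟩ := exists_dense_zpowers e
  set Ψ := powerSeriesEquivIwasawa (O := O) e hγ
  have := IwasawaAlgebra.isDomain (O := O) e
  have := IwasawaAlgebra.isNoetherianRing (O := O) e
  have := IwasawaAlgebra.isLocalRing (O := O) e
  have : UniqueFactorizationMonoid (IwasawaAlgebra p O Γ) :=
    Ψ.toMulEquiv.uniqueFactorizationMonoid uniqueFactorizationMonoid_powerSeries
  have hprime := IwasawaAlgebra.prime_uniformizer hϖ e
  have hpid : IsPrincipalIdealRing
      (IwasawaAlgebra p O Γ ⧸ Ideal.span {algebraMap O (IwasawaAlgebra p O Γ) ϖ}) := by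
    have := isPrincipalIdealRing_quotient_C_uniformizer hϖ
    let E := Ideal.quotientEquiv (Ideal.span {(C ϖ : O⟦X⟧)})
      (Ideal.span {algebraMap O (IwasawaAlgebra p O Γ) ϖ}) Ψ.toRingEquiv
      (by
        rw [Ideal.map_span, Set.image_singleton, ← powerSeriesEquivIwasawa_C e hγ]
        rfl)
    exact IsPrincipalIdealRing.of_surjective E.toRingHom E.surjective
  have hjac : algebraMap O (IwasawaAlgebra p O Γ) ϖ ∈
      Ideal.jacobson (⊥ : Ideal (IwasawaAlgebra p O Γ)) := by
    rw [IsLocalRing.jacobson_eq_maximalIdeal ⊥ bot_ne_top]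
    exact hprime.not_isUnit
  have hfin : ∀ a b : IwasawaAlgebra p O Γ, IsRelPrime a b →
      Finite (IwasawaAlgebra p O Γ ⧸ Ideal.span {a, b}) := by
    intro a b hab
    have hab' : IsRelPrime (Ψ.symm a) (Ψ.symm b) := fun c hca hcb => by
      have h := hab (d := Ψ c) ((map_dvd Ψ hca).trans (by rw [Ψ.apply_symm_apply]))
        ((map_dvd Ψ hcb).trans (by rw [Ψ.apply_symm_apply]))
      exact (MulEquiv.isUnit_map Ψ).1 h
    have := finite_quotient_span_pair_powerSeries _ _ hab'
    exact Finite.of_equiv _ (Ideal.quotientEquiv (Ideal.span {Ψ.symm a, Ψ.symm b})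
      (Ideal.span {a, b}) Ψ.toRingEquiv (by
        rw [Ideal.map_span, Set.image_pair]
        exact congrArg₂ (fun x y => Ideal.span {x, y}) (Ψ.apply_symm_apply a).symm
          (Ψ.apply_symm_apply b).symm)).toEquiv
  obtain ⟨r, ι, hι, π, n, f, hπ, hf⟩ := exists_isPseudoIso_elementary M hprime hjac hfin
  have hI : ∀ i, (∃ m, 1 ≤ m ∧ Ideal.span {π i ^ n i} =
      Ideal.span {algebraMap O (IwasawaAlgebra p O Γ) ϖ ^ m}) ∨
      ∃ F : Polynomial O, F.IsDistinguishedAt (maximalIdeal O) ∧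
        Ideal.span {π i ^ n i} = Ideal.span {polyAt p γ F} := by
    intro i
    -- the exponent `0` gives the zero module, which is the quotient by the polynomial `1`
    have hone : (1 : Polynomial O).IsDistinguishedAt (maximalIdeal O) :=
      isDistinguishedAt_of_map_eq_X_pow Polynomial.monic_one (k := 0) (by simp)
    rcases Nat.eq_zero_or_pos (n i) with h0 | hpos
    · exact Or.inr ⟨1, hone, by rw [h0, pow_zero, polyAt, map_one]⟩
    have hπ' : Prime (Ψ.symm (π i)) := (MulEquiv.prime_iff Ψ.symm).2 (hπ i)
    rcases associated_of_prime_powerSeries hϖ hπ' with h | ⟨q, hq, h⟩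
    · refine Or.inl ⟨n i, hpos, Ideal.span_singleton_eq_span_singleton.2 (Associated.pow_pow ?_)⟩
      have := h.map Ψ
      rwa [Ψ.apply_symm_apply, powerSeriesEquivIwasawa_C e hγ] at this
    · have hqn : ∀ k, (q ^ k).IsDistinguishedAt (maximalIdeal O) := fun k => by
        induction k with
        | zero => rwa [pow_zero]
        | succ k ih => rw [pow_succ]; exact ih.mul hq
      refine Or.inr ⟨q ^ n i, hqn _, Ideal.span_singleton_eq_span_singleton.2 ?_⟩
      rw [polyAt, map_pow]
      refine Associated.pow_pow ?_
      have := h.map Ψ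
      rwa [Ψ.apply_symm_apply, powerSeriesEquivIwasawa_coe e hγ] at this
  obtain ⟨s, t, a, F, f', ha, hF, hf'⟩ := exists_isPseudoIso_sorted hf
    (algebraMap O (IwasawaAlgebra p O Γ) ϖ) (polyAt p γ)
    (fun F => F.IsDistinguishedAt (maximalIdeal O)) hI
  exact ⟨_, γ, r, s, t, a, F, f', hγ, ha, hF, hf', rfl⟩

/-- The `μ`-invariant vanishes if and only if `M / ϖ M` has the same rank over `Λ / ϖ` as `M`
over `Λ`: in general the former exceeds the latter by the number of factors `Λ / (ϖ ^ a)`. -/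
theorem hasMuInvariant_eq_zero_iff (hϖ : Irreducible ϖ) (e : Γ ≃ₜ* Multiplicative ℤ_[p])
    {M : Type*} [AddCommGroup M] [Module (IwasawaAlgebra p O Γ) M]
    [Module.Finite (IwasawaAlgebra p O Γ) M] {m : ℕ} (hm : HasMuInvariant p Γ ϖ M m) :
    m = 0 ↔ Module.finrank
      (IwasawaAlgebra p O Γ ⧸ Ideal.span {algebraMap O (IwasawaAlgebra p O Γ) ϖ})
      (ModUniformizer p Γ ϖ M) = Module.finrank (IwasawaAlgebra p O Γ) M := by
  obtain ⟨γ, r, s, t, a, F, f, hγ, ha, hF, hf, rfl⟩ := hm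
  have := IwasawaAlgebra.isDomain (O := O) e
  have := IwasawaAlgebra.isNoetherianRing (O := O) e
  have := IwasawaAlgebra.isLocalRing (O := O) e
  have hprime := IwasawaAlgebra.prime_uniformizer hϖ e
  have hXdvd := not_dvd_polyAt hϖ e hγ (Polynomial.monic_X (R := O))
  have hX : polyAt p γ (Polynomial.X : Polynomial O) ∈ maximalIdeal (IwasawaAlgebra p O Γ) := by
    rw [mem_maximalIdeal, mem_nonunits_iff, ← powerSeriesEquivIwasawa_coe e hγ, MulEquiv.isUnit_map,
      Polynomial.coe_X]
    exact X_mem_maximalIdeal_powerSeries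
  have hdvd : ∀ j, ¬ algebraMap O (IwasawaAlgebra p O Γ) ϖ ∣ polyAt p γ (F j) := fun j =>
    not_dvd_polyAt hϖ e hγ (hF j).monic
  have hne : ∀ {y : IwasawaAlgebra p O Γ}, ¬ algebraMap O (IwasawaAlgebra p O Γ) ϖ ∣ y → y ≠ 0 :=
    fun {y} hy h => hy (h ▸ dvd_zero _)
  rw [finrank_quotient_eq_of_isPseudoIso hprime hX hXdvd ha hdvd hf,
    finrank_eq_of_isPseudoIso hprime hX (hne hXdvd) (fun j => hne (hdvd j)) hf]
  constructor
  · intro h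
    rcases Nat.eq_zero_or_pos s with rfl | hs
    · rfl
    · have h1 := Finset.sum_eq_zero_iff.1 h ⟨0, hs⟩ (Finset.mem_univ _)
      have h2 := ha ⟨0, hs⟩
      omega
  · intro h
    obtain rfl : s = 0 := by omega
    simp

theorem muInvariant_eq_zero_iff [Finite (ResidueField O)] (hϖ : Irreducible ϖ)
    (e : Γ ≃ₜ* Multiplicative ℤ_[p]) (M : Type*) [AddCommGroup M]
    [Module (IwasawaAlgebra p O Γ) M] [Module.Finite (IwasawaAlgebra p O Γ) M] :
    muInvariant p Γ ϖ M = 0 ↔ Module.finrank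
      (IwasawaAlgebra p O Γ ⧸ Ideal.span {algebraMap O (IwasawaAlgebra p O Γ) ϖ})
      (ModUniformizer p Γ ϖ M) = Module.finrank (IwasawaAlgebra p O Γ) M :=
  hasMuInvariant_eq_zero_iff hϖ e (Nat.sInf_mem (exists_hasMuInvariant hϖ e M))

end MuInvariant

theorem mainTheorem8 (p : ℕ) [Fact p.Prime]
    -- `O` is the ring of integers of a finite extension of `ℚ_p`, with uniformizer `ϖ`
    (O : Type*) [CommRing O] [IsDomain O] [IsDiscreteValuationRing O] [CharZero O]
    [IsAdicComplete (IsLocalRing.maximalIdeal O) O]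
    [Finite (IsLocalRing.ResidueField O)] [CharP (IsLocalRing.ResidueField O) p]
    (ϖ : O) (hϖ : Irreducible ϖ)
    -- `Γ` is a topological group isomorphic to `ℤ_p`
    (Γ : Type*) [CommGroup Γ] [TopologicalSpace Γ] [IsTopologicalGroup Γ]
    (hΓ : Nonempty (Γ ≃ₜ* Multiplicative ℤ_[p]))
    (M : Type*) [AddCommGroup M] [Module (IwasawaAlgebra p O Γ) M]
    [Module.Finite (IwasawaAlgebra p O Γ) M]
    (M' : Type*) [AddCommGroup M'] [Module (IwasawaAlgebra p O Γ) M']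
    [Module.Finite (IwasawaAlgebra p O Γ) M']
    (hrank : Module.finrank (IwasawaAlgebra p O Γ) M = Module.finrank (IwasawaAlgebra p O Γ) M')
    (hmod : Nonempty
      (ModUniformizer p Γ ϖ M ≃ₗ[IwasawaAlgebra p O Γ] ModUniformizer p Γ ϖ M')) :
    muInvariant p Γ ϖ M = 0 ↔ muInvariant p Γ ϖ M' = 0 := by
  obtain ⟨e⟩ := hΓ
  obtain ⟨φ⟩ := hmod
  rw [muInvariant_eq_zero_iff hϖ e M, muInvariant_eq_zero_iff hϖ e M', hrank,
    (φ.extendScalarsOfSurjective Ideal.Quotient.mk_surjective).finrank_eq]
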